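/- **Games.** A game graph $G=(V=V^0\,\dot\cup\,V^1,E)$ is a finite directed graph in which every vertex has a successor. A play is an infinite path of $G$. An objective $\Phi$ is an LTL formula whose atoms are sets of vertices; $\mathcal L(\Phi)$ is the set of plays satisfying it; a set of edges, used as a formula, means that one of these edges is taken now. A strategy of Player $i$ maps each history ending in $V^i$ to a successor of its last vertex; $\langle\!\langle i\rangle\!\rangle\Phi$ is the set of vertices from which Player $i$ has a strategy all of whose compliant plays satisfy $\Phi$, and $\langle\!\langle 0,1\rangle\!\rangle\Phi$ is the set of vertices from which some strategy profile yields a play satisfying $\Phi$. For $\mathbb P:V\to[0;d]$, $\mathit{Parity}(\mathbb P)$ says that the highest priority seen infinitely often is even; $P^j=\{v:\mathbb P(v)=j\}$. A pair $(\Phi_0^\bullet,\Phi_1^\bullet)$ is *iRmaC* (independently realizable and maximally cooperative) for $(G,\Phi_0,\Phi_1)$ if $\mathcal L(\Phi_0\wedge\Phi_1)=\mathcal L(\Phi_0^\bullet\wedge\Phi_1^\bullet)$ and $\langle\!\langle 0,1\rangle\!\rangle(\Phi_0\wedge\Phi_1)=\langle\!\langle 0\rangle\!\rangle\Phi^\bullet_0\cap\langle\!\langle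 1\rangle\!\rangle\Phi_1^\bullet$. **Templates.** A template $\Lambda\lhd(S,D,\mathcal H)$, with $S,D\subseteq E$ and $\mathcal H$ a set of pairs $(R,H_\ell)$ of a vertex set $R$ and a set $H_\ell$ of edge sets (live groups), is the formula $$\square\bigwedge_{e\in S}\neg e\ \wedge\ \bigwedge_{e\in D}\lozenge\square\neg e\ \wedge\bigwedge_{(R,H_\ell)\in\mathcal H}\Big(\square\lozenge R\Rightarrow\bigwedge_{H\in H_\ell}(\square\lozenge\, src(H)\Rightarrow\square\lozenge H)\Big).$$ Conjunction of templates is componentwise union. $\textsc{CheckTemplate}(G,\Lambda)$ is true iff every vertex has an outgoing edge outside $S\cup D$ and, for each live group $H$ in $\mathcal H$, every source of $H$ has an outgoing edge in $H\setminus(S\cup D)$. **Auxiliary procedures.** For $X\subseteq V$, the following refer to the restricted graph $G|_X$; cooperative regions in $G|_X$ consist of the vertices from which some infinite path inside $X$ satisfies the objective. $\mathsf{cpre}^a(U)$ is the set of vertices of Player $a$ with some successor in $U$ and of vertices of Player $1-a$ with all successors in $U$; $\mathsf{cpre}^{a,0}(U)=U$, $\mathsf{cpre}^{a,k+1}(U)=\mathsf{cpre}^a(\mathsf{cpre}^{a,k}(U))\cup\mathsf{cpre}^{a,k}(U)$.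 * $\textsc{Live}(X,I,i)$: start with $U=I$; while $U\ne X$: for each $k\ge1$ add to $H^s_\ell$ the live group of all edges of Player $i$ from $\mathsf{cpre}^{i,k}(U)$ to $\mathsf{cpre}^{i,k-1}(U)$; set $U:=\bigcup_k\mathsf{cpre}^{i,k}(U)$; let $C=\mathsf{cpre}^{1-i}(U)$; add to $H^a_\ell$ the live group of all edges of Player $1-i$ from $C$ to $U$; set $U:=U\cup C$. Return $(H^s_\ell,H^a_\ell)$. * $\textsc{CoLive}(X,I,i)$: let $U$ be the cooperative region of $\square I$ and $D$ the set of edges from $U$ to $X\setminus U$; while $U\neq X$: let $Q$ be the set of vertices outside $U$ with an edge into $U$; add to $D$ all edges inside $Q$; set $U:=U\cup Q$; add to $D$ all edges from $U$ to $X\setminus U$. Return the edges of $D$ of Player $i$ (for $D^s$) and of Player $1-i$ (for $D^a$). * $\textsc{ComputeSets}(X,\mathbb P,i)$ accumulates $\mathcal C,D^s,D^a,\mathcal H^s,\mathcal H^a$, initially empty. If $X=\emptyset$, stop. Let $d$ be the highest priority in $X$. If $d$ is odd, let $W_{\neg d}$ be the cooperative region of $\mathit{Parity}(\mathbb P)$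 in $G|_{X\setminus P^d}$, add the result of $\textsc{CoLive}(X,W_{\neg d},i)$ to $(D^s,D^a)$ and $X\setminus W_{\neg d}$ to $\mathcal C$. If $d$ is even, let $W_d$ be the cooperative region of $\square\lozenge P^d$ in $G|_X$ and $W_{\neg d}=X\setminus W_d$; for each odd $l\le d$ let $(H_\ell^s,H_\ell^a)=\textsc{Live}(W_d,\,W_d\cap(P^{l+1}\cup P^{l+3}\cup\dots\cup P^d),\,i)$ and add $(W_d\cap P^l,H_\ell^s)$ to $\mathcal H^s$ and $(W_d\cap P^l,H_\ell^a)$ to $\mathcal H^a$. If $d>0$, continue with $W_{\neg d}$ in place of $X$ and priority $d$ changed to $0$; otherwise stop. * $\textsc{ParityTemp}(X,\mathbb P,i)$, for the objective $\square X\wedge\mathit{Parity}(\mathbb P)$ on $G$: let $\mathcal W_i$ be the cooperative region of $\mathit{Parity}(\mathbb P)$ in $G|_X$; let $S^s$ (resp. $S^a$) be the set of edges of $G$ of Player $i$ (resp. $1-i$) from $Z$ to $V\setminus Z$, where $Z$ is the cooperative region of $\square\mathcal W_i$ in $G$; run $\textsc{ComputeSets}(\mathcal W_i,\mathbb P,i)$.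 Return $\mathcal W_i$, $\mathcal C_i=\mathcal C$, the assumption template $\Psi_i\lhd(S^a,D^a,\mathcal H^a)$ and the strategy template $\Pi_i\lhd(S^s,D^s,\mathcal H^s)$; the pair $(\Psi_i,\Pi_i)$ is a contracted strategy-mask (CSM). **Negotiate.** $\textsc{Negotiate}(G,\Phi_0,\Phi_1)$ with $\Phi_i=\mathit{Parity}(\mathbb P_i)$ starts with $X=V$. In each round it computes $(\mathcal W_i,\mathcal C_i,\Psi_i,\Pi_i)=\textsc{ParityTemp}(X,\mathbb P_i,i)$ for $i=0,1$. If $\textsc{CheckTemplate}(G,\Psi_{1-i}\wedge\Pi_i)$ is true for both $i$, it returns $(\Phi_0,\Phi_1),(\Psi_0,\Pi_0),(\Psi_1,\Pi_1)$. Otherwise it repeats with $$\Phi_i:=\Phi_i\wedge\square(\mathcal W_0\cap\mathcal W_1)\wedge\lozenge\square\neg(\mathcal C_0\cup\mathcal C_1),\qquad X:=\mathcal W_0\cap\mathcal W_1,$$ and with all vertices of $\mathcal C_0\cup\mathcal C_1$ given priority $2d_i+1$ in $\mathbb P_i$, where $d_i$ is the highest value of $\mathbb P_i$. **Theorem.**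 Let $G$ be a game graph, $\Phi_i=\mathit{Parity}(\mathbb P_i)$ for $i=0,1$, and let $((\Phi_0'',\Phi_1''),(\Psi_0,\Pi_0),(\Psi_1,\Pi_1))$ be the output of $\textsc{Negotiate}(G,\Phi_0,\Phi_1)$. Then $(\Phi_0^\bullet,\Phi_1^\bullet)$ with $\Phi_i^\bullet:=\Psi_{1-i}\wedge(\Psi_i\Rightarrow\Phi_i'')$ are iRmaC-specifications for $(G,\Phi_0,\Phi_1)$. -/

import Mathlib

namespace Negotiation

/-! ### Linear temporal logic over a vertex set -/

/-- LTL formulas whose atomic propositions are sets of vertices. -/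
inductive LTL (V : Type*) where
  | tt : LTL V
  | atom (A : Set V) : LTL V
  | neg (φ : LTL V) : LTL V
  | and (φ ψ : LTL V) : LTL V
  | next (φ : LTL V) : LTL V
  | untl (φ ψ : LTL V) : LTL V

namespace LTL

variable {V : Type*}

/-- `φ.sat ρ k`: the suffix of the infinite word `ρ` starting at position `k` satisfies `φ`. -/
def sat : LTL V → (ℕ → V) → ℕ → Prop
  | tt, _, _ => True
  | atom A, ρ, k => ρ k ∈ A
  | neg φ, ρ, k => ¬ φ.sat ρ k
  | and φ ψ, ρ, k => φ.sat ρ k ∧ ψ.sat ρ k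
  | next φ, ρ, k => φ.sat ρ (k + 1)
  | untl φ ψ, ρ, k => ∃ j, k ≤ j ∧ ψ.sat ρ j ∧ ∀ m, k ≤ m → m < j → φ.sat ρ m

/-- Disjunction. -/
def or (φ ψ : LTL V) : LTL V := neg (and (neg φ) (neg ψ))

/-- Implication. -/
def imp (φ ψ : LTL V) : LTL V := neg (and φ (neg ψ))

/-- The temporal operator "eventually" (diamond). -/
def ev (φ : LTL V) : LTL V := untl tt φ

/-- The temporal operator "always" (box). -/
def alw (φ : LTL V) : LTL V := neg (ev (neg φ))

/-- "Infinitely often": box diamond. -/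
def infOften (φ : LTL V) : LTL V := alw (ev φ)

/-- Finite conjunction of the formulas `f x`, `x ∈ s`. -/
noncomputable def conj {ι : Type*} (s : Finset ι) (f : ι → LTL V) : LTL V :=
  (s.toList.map f).foldr and tt

/-- Finite disjunction of the formulas `f x`, `x ∈ s`. -/
noncomputable def disj {ι : Type*} (s : Finset ι) (f : ι → LTL V) : LTL V :=
  neg (conj s fun x => neg (f x))

/-- Conjunction over a subset of a finite type. -/
noncomputable def conjS {ι : Type*} [Finite ι] (s : Set ι) (f : ι → LTL V) : LTL V :=
  conj (Set.toFinite s).toFinset f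

/-- Disjunction over a subset of a finite type. -/
noncomputable def disjS {ι : Type*} [Finite ι] (s : Set ι) (f : ι → LTL V) : LTL V :=
  disj (Set.toFinite s).toFinset f

end LTL

/-! ### Game graphs, plays, objectives -/

/-- A game graph: vertices `V` (finite wherever it matters), partitioned by `owner` into the
vertices of Player 0 and of Player 1; every vertex has a successor. -/
structure GameGraph (V : Type*) where
  owner : V → Fin 2
  edge : V → V → Prop
  serial : ∀ v, ∃ w, edge v w

section Games

variable {V : Type*}

/-- A play is an infinite path of the game graph. -/
def IsPlay (G : GameGraph V) (ρ : ℕ → V) : Prop := ∀ k, G.edge (ρ k) (ρ (k + 1))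

/-- The plays that satisfy `Φ`. -/
def Lang (G : GameGraph V) (Φ : LTL V) : Set (ℕ → V) := {ρ | IsPlay G ρ ∧ Φ.sat ρ 0}

/-- The vertices of priority `j`. -/
def prioSet (P : V → ℕ) (j : ℕ) : Set V := {v | P v = j}

/-- The largest priority that occurs in `X` (used for nonempty, finite `X`). -/
noncomputable def topPrio (P : V → ℕ) (X : Set V) : ℕ := sSup (P '' X)

/-- The parity objective (max-even) of the priority function `P`:
for every odd `i ≤ d`, if priority `i` is seen infinitely often, then so is some even
priority in `[i+1; d]`. -/
noncomputable def parity (P : V → ℕ) : LTL V :=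
  LTL.conj ((Finset.range (topPrio P Set.univ + 1)).filter fun i => i % 2 = 1) fun i =>
    LTL.imp (LTL.infOften (LTL.atom (prioSet P i)))
      (LTL.disj ((Finset.Icc (i + 1) (topPrio P Set.univ)).filter fun j => j % 2 = 0) fun j =>
        LTL.infOften (LTL.atom (prioSet P j)))

/-- A strategy of Player `i`: maps a history `ρ` and a current vertex `v` to a successor of `v`,
whenever `v` belongs to Player `i`. Values at the other player's vertices are never used. -/
structure Strategy (G : GameGraph V) (i : Fin 2) where
  move : List V → V → V
  legal : ∀ h v, G.owner v = i → G.edge v (move h v)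

/-- The play `ρ` is compliant with the strategy `π`. -/
def Compliant {G : GameGraph V} {i : Fin 2} (π : Strategy G i) (ρ : ℕ → V) : Prop :=
  ∀ k, G.owner (ρ k) = i → ρ (k + 1) = π.move ((List.range k).map ρ) (ρ k)

/-- The winning region of Player `i` for the objective `Φ`. -/
def winRegion (G : GameGraph V) (i : Fin 2) (Φ : LTL V) : Set V :=
  {v | ∃ π : Strategy G i, ∀ ρ, IsPlay G ρ → Compliant π ρ → ρ 0 = v → Φ.sat ρ 0}

/-- The cooperative winning region for the objective `Φ`: some strategy profile is such that the
play from `v` that is compliant with it satisfies `Φ`. -/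
def coopRegion (G : GameGraph V) (Φ : LTL V) : Set V :=
  {v | ∃ (π₀ : Strategy G 0) (π₁ : Strategy G 1), ∀ ρ, IsPlay G ρ →
    Compliant π₀ ρ → Compliant π₁ ρ → ρ 0 = v → Φ.sat ρ 0}

/-- The pair `Φb` is independently realizable and maximally cooperative for the two-objective game
`(G, Φ 0, Φ 1)`. -/
def IsIRmaC (G : GameGraph V) (Φ Φb : Fin 2 → LTL V) : Prop :=
  Lang G ((Φ 0).and (Φ 1)) = Lang G ((Φb 0).and (Φb 1)) ∧
  coopRegion G ((Φ 0).and (Φ 1)) = winRegion G 0 (Φb 0) ∩ winRegion G 1 (Φb 1)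

/-! ### Templates -/

/-- The data `(S, D, H)` of a template: `S` the edges that must never be taken, `D` the co-live
edges, `H` the conditional live groups `(R, Hl)`, with `Hl` a set of live groups. -/
structure Template (V : Type*) where
  S : Set (V × V)
  D : Set (V × V)
  H : Set (Set V × Set (Set (V × V)))

/-- The formula "the edge `e` is taken now". -/
def edgeF (e : V × V) : LTL V := (LTL.atom {e.1}).and (LTL.next (LTL.atom {e.2}))

/-- Sources of a set of edges. -/
def src (H : Set (V × V)) : Set V := Prod.fst '' H

/-- The live-group template. -/
noncomputable def liveF [Finite V] (Hl : Set (Set (V × V))) : LTL V :=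
  LTL.conjS Hl fun H =>
    LTL.imp (LTL.infOften (LTL.atom (src H))) (LTL.infOften (LTL.disjS H edgeF))

/-- The formula of a template: safety, co-liveness and conditional live-group parts. -/
noncomputable def Template.formula [Finite V] (T : Template V) : LTL V :=
  ((LTL.alw (LTL.conjS T.S fun e => (edgeF e).neg)).and
    (LTL.conjS T.D fun e => LTL.ev (LTL.alw (edgeF e).neg))).and
    (LTL.conjS T.H fun c => LTL.imp (LTL.infOften (LTL.atom c.1)) (liveF c.2))

/-- Conjunction of two templates. -/
def Template.conj (T T' : Template V) : Template V := ⟨T.S ∪ T'.S, T.D ∪ T'.D, T.H ∪ T'.H⟩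

/-- The condition tested by `CheckTemplate`: every vertex has an outgoing edge outside `D ∪ S`, and
every source of a live group has an outgoing edge in that group outside `D ∪ S`. -/
def CheckTemplate (G : GameGraph V) (T : Template V) : Prop :=
  (∀ v, ∃ w, G.edge v w ∧ (v, w) ∉ T.D ∪ T.S) ∧
  (∀ c ∈ T.H, ∀ H ∈ c.2, ∀ v ∈ src H, ∃ w, (v, w) ∈ H ∧ (v, w) ∉ T.D ∪ T.S)

/-! ### The procedure `ParityTemp`

In what follows `X` is a set of vertices and stands for the restricted game graph `G|_X`. -/

/-- Cooperative winning region of `Φ` in `G|_X`. (A strategy profile produces one play from each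
vertex, so this is the set of vertices from which some infinite path inside `X` satisfies `Φ`.) -/
def coopIn (G : GameGraph V) (X : Set V) (Φ : LTL V) : Set V :=
  {v | ∃ ρ, IsPlay G ρ ∧ (∀ k, ρ k ∈ X) ∧ ρ 0 = v ∧ Φ.sat ρ 0}

/-- Controllable predecessor of Player `a` in `G|_X`. -/
def cpre (G : GameGraph V) (X : Set V) (a : Fin 2) (U : Set V) : Set V :=
  {v ∈ X | G.owner v = a ∧ ∃ u ∈ X, G.edge v u ∧ u ∈ U} ∪
  {v ∈ X | G.owner v = 1 - a ∧ ∀ u ∈ X, G.edge v u → u ∈ U}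

/-- Iterated controllable predecessor, containing `U`: the vertices from which Player `a` can force
a visit to `U` in at most `k` steps. -/
def cpreIter (G : GameGraph V) (X : Set V) (a : Fin 2) (U : Set V) : ℕ → Set V
  | 0 => U
  | k + 1 => cpre G X a (cpreIter G X a U k) ∪ cpreIter G X a U k

/-- Attractor, without `U` itself. -/
def attr (G : GameGraph V) (X : Set V) (a : Fin 2) (U : Set V) : Set V :=
  (⋃ k, cpreIter G X a U (k + 1)) \ U

/-- The live groups returned with the attractor: for every `k ≥ 1` the edges of Player `a` from
`cpreIter k` to `cpreIter (k - 1)`. -/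
def attrGroups (G : GameGraph V) (X : Set V) (a : Fin 2) (U : Set V) : Set (Set (V × V)) :=
  Set.range fun k => {e | G.edge e.1 e.2 ∧ G.owner e.1 = a ∧
    e.1 ∈ cpreIter G X a U (k + 1) ∧ e.2 ∈ cpreIter G X a U k}

/-- Value of the variable `U` of `Live` after `k` passes of the loop. -/
def liveU (G : GameGraph V) (X I : Set V) (i : Fin 2) : ℕ → Set V
  | 0 => I
  | k + 1 =>
    let U := liveU G X I i k ∪ attr G X i (liveU G X I i k)
    U ∪ cpre G X (1 - i) U

/-- Strategy part of `Live(G|_X, I, i)`: the attractor groups of all passes of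
`while U ≠ X`. -/
def liveS (G : GameGraph V) (X I : Set V) (i : Fin 2) : Set (Set (V × V)) :=
  {H | ∃ k, liveU G X I i k ≠ X ∧ H ∈ attrGroups G X i (liveU G X I i k)}

/-- The live group of Player `1 - i` formed from the target set `U`: its edges from
`cpre (1 - i) U` to `U`. -/
def frontGroup (G : GameGraph V) (X : Set V) (i : Fin 2) (U : Set V) : Set (V × V) :=
  {e | G.edge e.1 e.2 ∧ G.owner e.1 = 1 - i ∧ e.1 ∈ cpre G X (1 - i) U ∧ e.2 ∈ U}

/-- Assumption part of `Live(G|_X, I, i)`: one group for each pass of `while U ≠ X`. -/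
def liveA (G : GameGraph V) (X I : Set V) (i : Fin 2) : Set (Set (V × V)) :=
  {H | ∃ k, liveU G X I i k ≠ X ∧
    H = frontGroup G X i (liveU G X I i k ∪ attr G X i (liveU G X I i k))}

/-- The vertices of `G|_X` outside `U` that have an edge into `U`. -/
def preNew (G : GameGraph V) (X U : Set V) : Set V :=
  {v ∈ X | v ∉ U ∧ ∃ u ∈ U, G.edge v u}

/-- Value of the variable `U` of `CoLive(G|_X, I)` after `k` passes of the loop. -/
def coLiveU (G : GameGraph V) (X I : Set V) : ℕ → Set V
  | 0 => coopIn G X (LTL.alw (LTL.atom I))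
  | k + 1 => coLiveU G X I k ∪ preNew G X (coLiveU G X I k)

/-- The co-live edges with source owned by Player `j` computed by `CoLive(G|_X, I)`. -/
def coLive (G : GameGraph V) (X I : Set V) (j : Fin 2) : Set (V × V) :=
  {e | G.edge e.1 e.2 ∧ G.owner e.1 = j ∧
    ((e.1 ∈ coLiveU G X I 0 ∧ e.2 ∈ X \ coLiveU G X I 0) ∨
     ∃ k, coLiveU G X I k ≠ X ∧
      ((e.1 ∈ preNew G X (coLiveU G X I k) ∧ e.2 ∈ preNew G X (coLiveU G X I k)) ∨
       (e.1 ∈ coLiveU G X I (k + 1) ∧ e.2 ∈ X \ coLiveU G X I (k + 1))))}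

/-- The sets collected by `ComputeSets`: the co-Büchi region, co-live edges and conditional live
groups, the last two for the strategy (`s`) and the assumption (`a`). -/
structure Sets (V : Type*) where
  C : Set V
  Ds : Set (V × V)
  Da : Set (V × V)
  Hs : Set (Set V × Set (Set (V × V)))
  Ha : Set (Set V × Set (Set (V × V)))

/-- Nothing collected. -/
def Sets.empty : Sets V := ⟨∅, ∅, ∅, ∅, ∅⟩

/-- Componentwise union. -/
def Sets.union (A B : Sets V) : Sets V :=
  ⟨A.C ∪ B.C, A.Ds ∪ B.Ds, A.Da ∪ B.Da, A.Hs ∪ B.Hs, A.Ha ∪ B.Ha⟩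

/-- The region `W_{¬d}` on which `ComputeSets` recurses, `d` being the top priority of `G|_X`. If
`d` is odd, it is the cooperative parity region of `G|_X` without the vertices of priority `d`; if
`d` is even, it is the complement of the cooperative Büchi region of these vertices. -/
noncomputable def nextRegion (G : GameGraph V) (X : Set V) (P : V → ℕ) : Set V :=
  if topPrio P X % 2 = 1 then coopIn G (X \ prioSet P (topPrio P X)) (parity P)
  else X \ coopIn G X (LTL.infOften (LTL.atom (prioSet P (topPrio P X))))

/-- The target of the live groups for the odd priority `l`, inside `W`: the union of the
priorities `l+1, l+3, …, d`. -/
def liveTarget (P : V → ℕ) (W : Set V) (d l : ℕ) : Set V :=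
  {v ∈ W | l < P v ∧ P v ≤ d ∧ P v % 2 = 0}

/-- The contribution of one level of `ComputeSets`. -/
noncomputable def levelSets (G : GameGraph V) (i : Fin 2) (X : Set V) (P : V → ℕ) : Sets V :=
  if topPrio P X % 2 = 1 then
    { C := X \ nextRegion G X P
      Ds := coLive G X (nextRegion G X P) i
      Da := coLive G X (nextRegion G X P) (1 - i)
      Hs := ∅
      Ha := ∅ }
  else
    let d := topPrio P X
    let W := coopIn G X (LTL.infOften (LTL.atom (prioSet P d)))
    { C := ∅
      Ds := ∅
      Da := ∅
      Hs := {c | ∃ l, l % 2 = 1 ∧ l ≤ d ∧ c = (W ∩ prioSet P l, liveS G W (liveTarget P W d l) i)}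
      Ha := {c | ∃ l, l % 2 = 1 ∧ l ≤ d ∧ c = (W ∩ prioSet P l, liveA G W (liveTarget P W d l) i)} }

/-- The priority function after merging priority `d` into priority `0`. -/
def mergeTop (P : V → ℕ) (d : ℕ) : V → ℕ := fun v => if P v = d then 0 else P v

theorem nextRegion_subset (G : GameGraph V) (X : Set V) (P : V → ℕ) : nextRegion G X P ⊆ X := by
  intro v hv
  unfold nextRegion at hv
  split_ifs at hv
  · obtain ⟨ρ, _, h, h0, _⟩ := hv
    exact h0 ▸ (h 0).1
  · exact hv.1

theorem topPrio_mergeTop_lt [Finite V] (P : V → ℕ) {X Y : Set V} (h : Y ⊆ X)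
    (hd : 0 < topPrio P X) : topPrio (mergeTop P (topPrio P X)) Y < topPrio P X := by
  have hle : topPrio (mergeTop P (topPrio P X)) Y ≤ topPrio P X - 1 := by
    apply csSup_le'
    rintro _ ⟨v, hv, rfl⟩
    have h1 : P v ≤ topPrio P X :=
      le_csSup (Set.toFinite (P '' X)).bddAbove ⟨v, h hv, rfl⟩
    simp only [mergeTop]
    split_ifs <;> omega
  omega

open Classical in
/-- `ComputeSets` on `G|_X` with priority function `P`, for Player `i`. -/
noncomputable def computeSets [Finite V] (G : GameGraph V) (i : Fin 2) (X : Set V) (P : V → ℕ) :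
    Sets V :=
  if X = ∅ then Sets.empty
  else if _hd : 0 < topPrio P X then
    (levelSets G i X P).union
      (computeSets G i (nextRegion G X P) (mergeTop P (topPrio P X)))
  else levelSets G i X P
termination_by topPrio P X
decreasing_by exact topPrio_mergeTop_lt P (nextRegion_subset G X P) _hd

/-- `Unsafe(G, U)`: the edges of `G`, with source owned by Player `j`, that leave the cooperative
winning region of "always `U`". -/
def safetyEdges (G : GameGraph V) (U : Set V) (j : Fin 2) : Set (V × V) :=
  {e | G.edge e.1 e.2 ∧ G.owner e.1 = j ∧
    e.1 ∈ coopIn G Set.univ (LTL.alw (LTL.atom U)) ∧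
    e.2 ∉ coopIn G Set.univ (LTL.alw (LTL.atom U))}

/-- Output of `ParityTemp`: winning region, co-Büchi region, assumption template, strategy
template. -/
structure TempOut (V : Type*) where
  W : Set V
  C : Set V
  Psi : Template V
  Pi : Template V

/-- `ParityTemp` for Player `i`, applied to the game on `G` with objective
"always `X`, and the parity objective of `P`". For `X = V` this is the parity game `(G, P)`. -/
noncomputable def parityTemp [Finite V] (G : GameGraph V) (X : Set V) (P : V → ℕ) (i : Fin 2) :
    TempOut V :=
  let Z := coopIn G X (parity P)
  let A := computeSets G i Z P
  { W := Z
    C := A.C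
    Psi := ⟨safetyEdges G Z (1 - i), A.Da, A.Ha⟩
    Pi := ⟨safetyEdges G Z i, A.Ds, A.Hs⟩ }

/-! ### The procedure `Negotiate` -/

/-- Output of `Negotiate`: the modified objectives, the assumption templates and the strategy
templates of the two players. -/
structure Output (V : Type*) where
  obj : Fin 2 → LTL V
  Psi : Fin 2 → Template V
  Pi : Fin 2 → Template V

/-- The test of a round: both templates `Ψ_{1-i} ∧ Π_i` pass `CheckTemplate`. -/
def RoundOK [Finite V] (G : GameGraph V) (X : Set V) (P : Fin 2 → V → ℕ) : Prop :=
  ∀ i : Fin 2, CheckTemplate G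
    ((parityTemp G X (P (1 - i)) (1 - i)).Psi.conj (parityTemp G X (P i) i).Pi)

/-- The set `W_0 ∩ W_1` of a round. -/
noncomputable def roundW [Finite V] (G : GameGraph V) (X : Set V) (P : Fin 2 → V → ℕ) : Set V :=
  (parityTemp G X (P 0) 0).W ∩ (parityTemp G X (P 1) 1).W

/-- The set `C_0 ∪ C_1` of a round. -/
noncomputable def roundC [Finite V] (G : GameGraph V) (X : Set V) (P : Fin 2 → V → ℕ) : Set V :=
  (parityTemp G X (P 0) 0).C ∪ (parityTemp G X (P 1) 1).C

open Classical in
/-- The priority function after giving all vertices of `C` the odd priority `2 d + 1`, where `d` is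
the top priority of `P`. -/
noncomputable def raise (P : V → ℕ) (C : Set V) : V → ℕ :=
  fun v => if v ∈ C then 2 * topPrio P Set.univ + 1 else P v

/-- `NegotiateFrom G X P Φ out`: `Negotiate`, called with the objectives `Φ 0`, `Φ 1`, returns
`out`. The pair `(X, P i)` is the parity game into which `(G, Φ i)` has been converted: always stay
in `X`, and satisfy the parity objective of `P i`. -/
inductive NegotiateFrom [Finite V] (G : GameGraph V) :
    Set V → (Fin 2 → V → ℕ) → (Fin 2 → LTL V) → Output V → Prop
  | ret (X : Set V) (P : Fin 2 → V → ℕ) (Φ : Fin 2 → LTL V) (h : RoundOK G X P) :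
      NegotiateFrom G X P Φ
        ⟨Φ, fun i => (parityTemp G X (P i) i).Psi, fun i => (parityTemp G X (P i) i).Pi⟩
  | step (X : Set V) (P : Fin 2 → V → ℕ) (Φ : Fin 2 → LTL V) (out : Output V)
      (h : ¬ RoundOK G X P)
      (hrec : NegotiateFrom G (roundW G X P) (fun i => raise (P i) (roundC G X P))
        (fun i => ((Φ i).and (LTL.alw (LTL.atom (roundW G X P)))).and
          (LTL.ev (LTL.alw (LTL.atom (roundC G X P)).neg))) out) :
      NegotiateFrom G X P Φ out

/-- `out` is the output of `Negotiate(G, Parity(P 0), Parity(P 1))`. -/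
def Negotiate [Finite V] (G : GameGraph V) (P : Fin 2 → V → ℕ) (out : Output V) : Prop :=
  NegotiateFrom G Set.univ P (fun i => parity (P i)) out

/-- The contracted local specification `Ψ_{1-i} ∧ (Ψ_i ⇒ Φ_i'')` of Player `i`. -/
noncomputable def contracted [Finite V] (out : Output V) (i : Fin 2) : LTL V :=
  (out.Psi (1 - i)).formula.and (LTL.imp (out.Psi i).formula (out.obj i))

end Games

end Negotiation

namespace Negotiation

open Filter

variable {V : Type*}

/-! ### Semantics of the formulas -/

namespace LTL

/-! Everything rests on two facts about one call of `parityTemp`. Completeness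
(`ParityHolds.parityTemp_complete`): a play in X satisfying parity stays in W, eventually avoids C
and satisfies Ψ. Soundness (`parityTemp_sound`): a play from W satisfying Ψ and Π satisfies the
objective. Both descend along the recursion of `computeSets`. Merging the top priority into 0 is
harmless because a play settling in the next region sees it only finitely often.

Completeness for both players shows that the conjuncts added in a round already follow from Φ₀ ∧ Φ₁.
So the conjunction of the objectives never changes (`NegotiateFrom.exists_final_round`), while each
objective remains a parity game on a smaller set (`Represents`). In the final round completeness
also gives Φ₀'' ∧ Φ₁'' ⇒ Ψ₀ ∧ Ψ₁, whence the equality of languages (`contracted_iff`).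

For realizability, Ψ_{1-i} and Π_i speak only of edges of Player i. Once `CheckTemplate` holds, a
strategy cycling fairly through the allowed edges enforces both (`CheckTemplate.exists_strategy`),
and from W_i soundness turns this into Ψ_i ⇒ Φ_i'' (`mem_winRegion_contracted`). Cooperatively
winning vertices lie in W₀ ∩ W₁; conversely, two winning strategies played together produce a play
in the common language. -/

theorem sat_imp {φ ψ : LTL V} {ρ : ℕ → V} {k : ℕ} :
    (imp φ ψ).sat ρ k ↔ (φ.sat ρ k → ψ.sat ρ k) := by
  simp [imp, sat]

theorem sat_ev {φ : LTL V} {ρ : ℕ → V} {k : ℕ} :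
    (ev φ).sat ρ k ↔ ∃ j, k ≤ j ∧ φ.sat ρ j := by
  simp [ev, sat]

theorem sat_alw {φ : LTL V} {ρ : ℕ → V} {k : ℕ} :
    (alw φ).sat ρ k ↔ ∀ j, k ≤ j → φ.sat ρ j := by
  simp [alw, sat, sat_ev]

theorem sat_infOften {φ : LTL V} {ρ : ℕ → V} {k : ℕ} :
    (infOften φ).sat ρ k ↔ ∃ᶠ j in atTop, φ.sat ρ j := by
  simp only [infOften, sat_alw, sat_ev, frequently_atTop]
  refine ⟨fun h a => ?_, fun h j _ => h j⟩
  obtain ⟨j, hj, hφ⟩ := h (max a k) (le_max_right _ _)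
  exact ⟨j, (le_max_left _ _).trans hj, hφ⟩

theorem sat_ev_alw {φ : LTL V} {ρ : ℕ → V} {k : ℕ} :
    (ev (alw φ)).sat ρ k ↔ ∀ᶠ j in atTop, φ.sat ρ j := by
  simp only [sat_alw, sat_ev, eventually_atTop]
  refine ⟨fun ⟨j, _, h⟩ => ⟨j, h⟩, fun ⟨a, h⟩ => ⟨max a k, le_max_right _ _, fun j hj =>
    h j ((le_max_left _ _).trans hj)⟩⟩

theorem sat_foldr_and {L : List (LTL V)} {ρ : ℕ → V} {k : ℕ} :
    (L.foldr and tt).sat ρ k ↔ ∀ φ ∈ L, φ.sat ρ k := by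
  induction L with
  | nil => simp [sat]
  | cons a L ih => simp [sat, ih]

theorem sat_conj {ι : Type*} {s : Finset ι} {f : ι → LTL V} {ρ : ℕ → V} {k : ℕ} :
    (conj s f).sat ρ k ↔ ∀ x ∈ s, (f x).sat ρ k := by
  simp [conj, sat_foldr_and]

theorem sat_disj {ι : Type*} {s : Finset ι} {f : ι → LTL V} {ρ : ℕ → V} {k : ℕ} :
    (disj s f).sat ρ k ↔ ∃ x ∈ s, (f x).sat ρ k := by
  simp [disj, sat, sat_conj]

theorem sat_conjS {ι : Type*} [Finite ι] {s : Set ι} {f : ι → LTL V} {ρ : ℕ → V} {k : ℕ} :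
    (conjS s f).sat ρ k ↔ ∀ x ∈ s, (f x).sat ρ k := by
  simp [conjS, sat_conj]

theorem sat_disjS {ι : Type*} [Finite ι] {s : Set ι} {f : ι → LTL V} {ρ : ℕ → V} {k : ℕ} :
    (disjS s f).sat ρ k ↔ ∃ x ∈ s, (f x).sat ρ k := by
  simp [disjS, sat_disj]

theorem sat_edgeF {e : V × V} {ρ : ℕ → V} {k : ℕ} :
    (edgeF e).sat ρ k ↔ (ρ k, ρ (k + 1)) = e := by
  simp [edgeF, sat, Prod.ext_iff]

end LTL

/-- The parity condition on a word: every odd priority seen infinitely often is exceeded by an even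
priority seen infinitely often. -/
def ParityHolds (P : V → ℕ) (ρ : ℕ → V) : Prop :=
  ∀ i, i % 2 = 1 → (∃ᶠ k in atTop, P (ρ k) = i) →
    ∃ j, i < j ∧ j % 2 = 0 ∧ ∃ᶠ k in atTop, P (ρ k) = j

/-- The co-live part of a template, on a word. -/
def CoLiveHolds (D : Set (V × V)) (ρ : ℕ → V) : Prop :=
  ∀ e ∈ D, ∀ᶠ k in atTop, (ρ k, ρ (k + 1)) ≠ e

/-- The conditional live-group part of a template, on a word. -/
def CondLiveHolds (H : Set (Set V × Set (Set (V × V)))) (ρ : ℕ → V) : Prop :=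
  ∀ c ∈ H, (∃ᶠ k in atTop, ρ k ∈ c.1) →
    ∀ K ∈ c.2, (∃ᶠ k in atTop, ρ k ∈ src K) → ∃ᶠ k in atTop, (ρ k, ρ (k + 1)) ∈ K

theorem le_topPrio [Finite V] (P : V → ℕ) {X : Set V} {v : V} (hv : v ∈ X) :
    P v ≤ topPrio P X :=
  le_csSup (Set.toFinite (P '' X)).bddAbove ⟨v, hv, rfl⟩

/-- The bounds by the top priority in `parity` can be dropped, since a priority that occurs at all
respects them. -/
theorem sat_parity [Finite V] {P : V → ℕ} {ρ : ℕ → V} {k : ℕ} :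
    (parity P).sat ρ k ↔ ParityHolds P ρ := by
  simp only [parity, LTL.sat_conj, LTL.sat_imp, LTL.sat_disj, LTL.sat_infOften, LTL.sat, prioSet,
    Set.mem_ofPred_eq, Finset.mem_filter, Finset.mem_range, Finset.mem_Icc, ParityHolds]
  constructor
  · intro h i hi hf
    obtain ⟨m, hm⟩ := hf.exists
    have := le_topPrio P (Set.mem_univ (ρ m))
    obtain ⟨j, hj, hjf⟩ := h i ⟨by omega, hi⟩ hf
    exact ⟨j, by omega, hj.2, hjf⟩
  · rintro h i ⟨_, hi⟩ hf
    obtain ⟨j, hij, hj, hjf⟩ := h i hi hf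
    obtain ⟨m, hm⟩ := hjf.exists
    have := le_topPrio P (Set.mem_univ (ρ m))
    exact ⟨j, ⟨⟨by omega, by omega⟩, hj⟩, hjf⟩

theorem sat_formula [Finite V] {T : Template V} {ρ : ℕ → V} :
    T.formula.sat ρ 0 ↔ (∀ k, (ρ k, ρ (k + 1)) ∉ T.S) ∧ CoLiveHolds T.D ρ ∧
      CondLiveHolds T.H ρ := by
  simp only [Template.formula, liveF, LTL.sat, LTL.sat_conjS, LTL.sat_alw, LTL.sat_imp,
    LTL.sat_infOften, LTL.sat_ev_alw, LTL.sat_disjS, LTL.sat_edgeF, CoLiveHolds, CondLiveHolds,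
    and_assoc, exists_eq_right']
  refine and_congr ⟨fun h k hk => h k (Nat.zero_le k) _ hk rfl, ?_⟩ Iff.rfl
  rintro h k - e he rfl
  exact h k he

/-- There are finitely many edges, so one time serves for all of them. -/
theorem CoLiveHolds.eventually [Finite V] {D : Set (V × V)} {ρ : ℕ → V} (h : CoLiveHolds D ρ) :
    ∀ᶠ k in atTop, (ρ k, ρ (k + 1)) ∉ D := by
  have : ∀ᶠ k in atTop, ∀ e : V × V, e ∈ D → (ρ k, ρ (k + 1)) ≠ e :=
    eventually_all.2 fun e => by
      by_cases he : e ∈ D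
      · filter_upwards [h e he] with k hk _ using hk
      · simp [he]
  filter_upwards [this] with k hk hD using hk _ hD rfl

theorem CoLiveHolds.of_eventually {D : Set (V × V)} {ρ : ℕ → V}
    (h : ∀ᶠ k in atTop, (ρ k, ρ (k + 1)) ∉ D) : CoLiveHolds D ρ := by
  rintro e he
  filter_upwards [h] with k hk hE
  exact hk (hE ▸ he)

theorem CoLiveHolds.union {D D' : Set (V × V)} {ρ : ℕ → V} :
    CoLiveHolds (D ∪ D') ρ ↔ CoLiveHolds D ρ ∧ CoLiveHolds D' ρ := by
  simp [CoLiveHolds, or_imp, forall_and]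

theorem CondLiveHolds.union {H H' : Set (Set V × Set (Set (V × V)))} {ρ : ℕ → V} :
    CondLiveHolds (H ∪ H') ρ ↔ CondLiveHolds H ρ ∧ CondLiveHolds H' ρ := by
  simp only [CondLiveHolds, Set.mem_union, or_imp, forall_and]

theorem ParityHolds.congr {P P' : V → ℕ} {ρ : ℕ → V}
    (h : ∀ᶠ k in atTop, P (ρ k) = P' (ρ k)) : ParityHolds P ρ ↔ ParityHolds P' ρ := by
  have key : ∀ j, (∃ᶠ k in atTop, P (ρ k) = j) ↔ ∃ᶠ k in atTop, P' (ρ k) = j := fun j =>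
    frequently_congr (by filter_upwards [h] with k hk; rw [hk])
  simp only [ParityHolds, key]

theorem frequently_shift {p : ℕ → Prop} (n : ℕ) :
    (∃ᶠ k in atTop, p (k + n)) ↔ ∃ᶠ k in atTop, p k := by
  conv_rhs => rw [← map_add_atTop_eq_nat n, frequently_map]

theorem ParityHolds.shift {P : V → ℕ} {ρ : ℕ → V} (n : ℕ) :
    ParityHolds P (fun k => ρ (k + n)) ↔ ParityHolds P ρ := by
  have key : ∀ j, (∃ᶠ k in atTop, P (ρ (k + n)) = j) ↔ ∃ᶠ k in atTop, P (ρ k) = j := fun j =>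
    frequently_shift (p := fun k => P (ρ k) = j) n
  simp only [ParityHolds, key]

theorem IsPlay.shift {G : GameGraph V} {ρ : ℕ → V} (h : IsPlay G ρ) (n : ℕ) :
    IsPlay G fun k => ρ (k + n) := fun k => by
  have := h (k + n)
  rwa [show k + n + 1 = k + 1 + n by omega] at this

/-- The infinite path that starts with `v` and continues with `ρ`. -/
def consPath (v : V) (ρ : ℕ → V) : ℕ → V
  | 0 => v
  | k + 1 => ρ k

theorem frequently_consPath {p : V → Prop} {v : V} {ρ : ℕ → V} :
    (∃ᶠ k in atTop, p (consPath v ρ k)) ↔ ∃ᶠ k in atTop, p (ρ k) :=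
  (frequently_shift (p := fun k => p (consPath v ρ k)) 1).symm

theorem IsPlay.consPath {G : GameGraph V} {v : V} {ρ : ℕ → V} (h : IsPlay G ρ)
    (hv : G.edge v (ρ 0)) : IsPlay G (consPath v ρ)
  | 0 => hv
  | k + 1 => h k

/-! ### Cooperative regions -/

theorem mem_coopIn_alw {G : GameGraph V} {X I : Set V} {v : V} :
    v ∈ coopIn G X (LTL.alw (LTL.atom I)) ↔
      ∃ ρ, IsPlay G ρ ∧ (∀ k, ρ k ∈ X ∩ I) ∧ ρ 0 = v := by
  simp only [coopIn, Set.mem_ofPred_eq, LTL.sat_alw, LTL.sat, Nat.zero_le, true_imp_iff,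
    Set.mem_inter_iff, forall_and]
  exact exists_congr fun ρ => by tauto

theorem mem_coopIn_buchi {G : GameGraph V} {X I : Set V} {v : V} :
    v ∈ coopIn G X (LTL.infOften (LTL.atom I)) ↔
      ∃ ρ, IsPlay G ρ ∧ (∀ k, ρ k ∈ X) ∧ ρ 0 = v ∧ ∃ᶠ k in atTop, ρ k ∈ I := by
  simp only [coopIn, Set.mem_ofPred_eq, LTL.sat_infOften, LTL.sat]

theorem mem_coopIn_parity [Finite V] {G : GameGraph V} {X : Set V} {P : V → ℕ} {v : V} :
    v ∈ coopIn G X (parity P) ↔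
      ∃ ρ, IsPlay G ρ ∧ (∀ k, ρ k ∈ X) ∧ ρ 0 = v ∧ ParityHolds P ρ := by
  simp only [coopIn, Set.mem_ofPred_eq, sat_parity]

theorem coopIn_subset {G : GameGraph V} {X : Set V} {Φ : LTL V} : coopIn G X Φ ⊆ X := by
  rintro v ⟨ρ, _, h, rfl, _⟩
  exact h 0

theorem ParityHolds.mem_coopIn [Finite V] {G : GameGraph V} {X : Set V} {P : V → ℕ} {ρ : ℕ → V}
    (h : ParityHolds P ρ) (hρ : IsPlay G ρ) {n : ℕ} (hX : ∀ k, n ≤ k → ρ k ∈ X) {k : ℕ}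
    (hk : n ≤ k) : ρ k ∈ coopIn G X (parity P) :=
  mem_coopIn_parity.2 ⟨fun m => ρ (m + k), hρ.shift k, fun m => hX _ (by omega), by simp,
    (ParityHolds.shift k).2 h⟩

/-- From every vertex of `X`, some infinite path inside `X` satisfies the parity condition. -/
def ParityLive (G : GameGraph V) (X : Set V) (P : V → ℕ) : Prop :=
  ∀ v ∈ X, ∃ ρ, IsPlay G ρ ∧ (∀ k, ρ k ∈ X) ∧ ρ 0 = v ∧ ParityHolds P ρ

/-- Parity ignores prefixes, so a winning path never leaves the region. `ParityLive` is the
invariant of the recursion in `computeSets`. -/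
theorem parityLive_coopIn [Finite V] (G : GameGraph V) (X : Set V) (P : V → ℕ) :
    ParityLive G (coopIn G X (parity P)) P := by
  intro v hv
  obtain ⟨ρ, hρ, hX, h0, hP⟩ := mem_coopIn_parity.1 hv
  exact ⟨ρ, hρ, fun k => hP.mem_coopIn hρ (n := 0) (fun k _ => hX k) (Nat.zero_le k), h0, hP⟩

/-- Identifies the initial set of `coLiveU` and the region in `safetyEdges` with the winning region
itself. -/
theorem ParityLive.coopIn_alw {G : GameGraph V} {X Z : Set V} {P : V → ℕ}
    (h : ParityLive G Z P) (hZ : Z ⊆ X) : coopIn G X (LTL.alw (LTL.atom Z)) = Z := by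
  ext v
  rw [mem_coopIn_alw]
  constructor
  · rintro ⟨ρ, _, hk, rfl⟩
    exact (hk 0).2
  · intro hv
    obtain ⟨ρ, hρ, hk, h0, _⟩ := h v hv
    exact ⟨ρ, hρ, fun k => ⟨hZ (hk k), hk k⟩, h0⟩

/-- If `A` cannot be left along `ρ` from some time on, then `ρ` eventually avoids `A` or eventually
stays in `A`. -/
theorem eventually_or_of_closed {A : Set V} {ρ : ℕ → V}
    (h : ∀ᶠ k in atTop, ρ k ∈ A → ρ (k + 1) ∈ A) :
    (∀ᶠ k in atTop, ρ k ∉ A) ∨ ∀ᶠ k in atTop, ρ k ∈ A := by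
  refine or_iff_not_imp_left.2 fun hA => ?_
  obtain ⟨n, hn⟩ := eventually_atTop.1 h
  obtain ⟨m, hm, hmA⟩ := frequently_atTop.1 (not_eventually.1 hA) n
  refine eventually_atTop.2 ⟨m, fun k hk => ?_⟩
  induction k, hk using Nat.le_induction with
  | base => exact not_not.1 hmA
  | succ k hk ih => exact hn k (hm.trans hk) ih

theorem eq_or_eq_one_sub (a i : Fin 2) : a = i ∨ a = 1 - i := by
  decide +revert

theorem one_sub_one_sub (i : Fin 2) : 1 - (1 - i) = i := by
  decide +revert

theorem frequently_mem_exists_eq [Finite V] {A : Set V} {ρ : ℕ → V}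
    (h : ∃ᶠ k in atTop, ρ k ∈ A) : ∃ v ∈ A, ∃ᶠ k in atTop, ρ k = v := by
  by_contra! hA
  have : ∀ᶠ k in atTop, ∀ v : V, v ∈ A → ρ k ≠ v := by
    refine eventually_all.2 fun v => ?_
    by_cases hv : v ∈ A
    · filter_upwards [hA v hv] with k hk _ using hk
    · simp [hv]
  obtain ⟨k, hk, hk'⟩ := (h.and_eventually this).exists
  exact hk' _ hk rfl

theorem frequently_mem_iUnion [Finite V] {A : ℕ → Set V} {ρ : ℕ → V}
    (h : ∃ᶠ k in atTop, ρ k ∈ ⋃ n, A n) : ∃ n, ∃ᶠ k in atTop, ρ k ∈ A n := by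
  obtain ⟨v, hv, hf⟩ := frequently_mem_exists_eq h
  obtain ⟨n, hn⟩ := Set.mem_iUnion.1 hv
  exact ⟨n, hf.mono fun k hk => hk.symm ▸ hn⟩

theorem mem_of_path {G : GameGraph V} {X A : Set V} {ρ : ℕ → V}
    (hA : ∀ v ∈ X, ∀ u ∈ X, u ∈ A → G.edge v u → v ∈ A) (hρ : IsPlay G ρ) (hX : ∀ k, ρ k ∈ X)
    {n : ℕ} (hn : ρ n ∈ A) : ρ 0 ∈ A := by
  induction n with
  | zero => exact hn
  | succ n ih => exact ih (hA _ (hX n) _ (hX (n + 1)) hn (hρ n))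

/-! ### Co-live edges -/

theorem coLiveU_subset {G : GameGraph V} {X I : Set V} (k : ℕ) : coLiveU G X I k ⊆ X := by
  induction k with
  | zero => exact coopIn_subset
  | succ k ih => exact Set.union_subset ih fun v hv => hv.1

theorem fst_mem_of_mem_coLive {G : GameGraph V} {X I : Set V} {j : Fin 2} {e : V × V}
    (he : e ∈ coLive G X I j) : e.1 ∈ X := by
  obtain ⟨-, -, h | ⟨k, -, h | h⟩⟩ := he
  · exact coLiveU_subset _ h.1
  · exact h.1.1
  · exact coLiveU_subset _ h.1

theorem coLiveU_zero_subset {G : GameGraph V} {X I : Set V} (k : ℕ) :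
    coLiveU G X I 0 ⊆ coLiveU G X I k := by
  induction k with
  | zero => exact subset_rfl
  | succ k ih => exact ih.trans Set.subset_union_left

theorem mem_iUnion_coLiveU {G : GameGraph V} {X I : Set V} {ρ : ℕ → V} (hρ : IsPlay G ρ)
    (hX : ∀ k, ρ k ∈ X) {n : ℕ} (hn : ρ n ∈ coLiveU G X I 0) :
    ρ 0 ∈ ⋃ k, coLiveU G X I k := by
  refine mem_of_path (fun v hv u _ hA hvu => ?_) hρ hX (Set.mem_iUnion.2 ⟨0, hn⟩)
  obtain ⟨k, hk⟩ := Set.mem_iUnion.1 hA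
  refine Set.mem_iUnion.2 ⟨k + 1, ?_⟩
  by_cases hvk : v ∈ coLiveU G X I k
  · exact Or.inl hvk
  · exact Or.inr ⟨hv, hvk, u, hk, hvu⟩

/-- Edges leaving a layer towards the rest of X are co-live, so a layer visited infinitely often is
eventually never left. If the layer below it were eventually avoided, the play would remain in the
frontier `preNew`, whose inner edges are co-live too. Hence the play descends to layer 0. -/
theorem eventually_mem_of_coLive [Finite V] {G : GameGraph V} {X I : Set V} {i : Fin 2} {ρ : ℕ → V}
    (hρ : IsPlay G ρ) (hX : ∀ᶠ k in atTop, ρ k ∈ X) (hreach : X ⊆ ⋃ k, coLiveU G X I k)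
    (hi : CoLiveHolds (coLive G X I i) ρ) (hi' : CoLiveHolds (coLive G X I (1 - i)) ρ) :
    ∀ᶠ k in atTop, ρ k ∈ coLiveU G X I 0 := by
  have hX' : ∀ᶠ k in atTop, ρ (k + 1) ∈ X := (tendsto_add_atTop_nat 1).eventually hX
  have hD : ∀ᶠ k in atTop, ∀ a, (ρ k, ρ (k + 1)) ∉ coLive G X I a := by
    filter_upwards [hi.eventually, hi'.eventually] with k h1 h2 a
    rcases eq_or_eq_one_sub a i with rfl | rfl
    exacts [h1, h2]
  have main : ∀ n, (∃ᶠ k in atTop, ρ k ∈ coLiveU G X I n) →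
      ∀ᶠ k in atTop, ρ k ∈ coLiveU G X I 0 := by
    intro n
    induction n with
    | zero =>
      intro hn
      refine (eventually_or_of_closed ?_).resolve_left fun h => hn h
      filter_upwards [hX', hD] with k hk hkD h0
      by_contra hc
      exact hkD _ ⟨hρ k, rfl, Or.inl ⟨h0, hk, hc⟩⟩
    | succ n ih =>
      intro hn
      -- Passes after the end of the loop contribute no edges, but then layer n is already all of X.
      by_cases hnX : coLiveU G X I n = X
      · exact ih (hX.frequently.mono fun k hk => hnX.symm ▸ hk)
      · have hcl : ∀ᶠ k in atTop, ρ k ∈ coLiveU G X I (n + 1) := by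
          refine (eventually_or_of_closed ?_).resolve_left fun h => hn h
          filter_upwards [hX', hD] with k hk hkD h0
          by_contra hc
          exact hkD _ ⟨hρ k, rfl, Or.inr ⟨n, hnX, Or.inr ⟨h0, hk, hc⟩⟩⟩
        by_contra hc
        have hno : ∀ᶠ k in atTop, ρ k ∉ coLiveU G X I n :=
          not_frequently.1 fun h => hc (ih h)
        have hQ : ∀ᶠ k in atTop, ρ k ∈ preNew G X (coLiveU G X I n) := by
          filter_upwards [hcl, hno] with k h1 h2 using h1.resolve_left h2
        have hQ' := (tendsto_add_atTop_nat 1).eventually hQ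
        obtain ⟨k, hk, hk', hkD⟩ := (hQ.and (hQ'.and hD)).exists
        exact hkD _ ⟨hρ k, rfl, Or.inr ⟨n, hnX, Or.inl ⟨hk, hk'⟩⟩⟩
  obtain ⟨n, hn⟩ := frequently_mem_iUnion (hX.mono fun k hk => hreach hk).frequently
  exact main n hn

theorem notMem_coLive {G : GameGraph V} {X I : Set V} {j : Fin 2} {v w : V}
    (hv : v ∈ coLiveU G X I 0) (hw : w ∈ coLiveU G X I 0) : (v, w) ∉ coLive G X I j := by
  rintro ⟨-, -, h | ⟨k, -, h | h⟩⟩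
  · exact h.2.2 hw
  · exact h.1.2.1 (coLiveU_zero_subset k hv)
  · exact h.2.2 (coLiveU_zero_subset (k + 1) hw)

/-! ### Live groups -/

theorem union_attr (G : GameGraph V) (X : Set V) (a : Fin 2) (U : Set V) :
    U ∪ attr G X a U = ⋃ k, cpreIter G X a U k := by
  ext v
  simp only [attr, Set.union_sdiff_self, Set.mem_union, Set.mem_iUnion]
  constructor
  · rintro (h | ⟨k, h⟩)
    exacts [⟨0, h⟩, ⟨k + 1, h⟩]
  · rintro ⟨_ | k, h⟩
    exacts [Or.inl h, Or.inr ⟨k, h⟩]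

theorem mem_union_attr_of_edge {G : GameGraph V} {X : Set V} {a : Fin 2} {U : Set V} {v u : V}
    (hv : v ∈ X) (hu : u ∈ X) (ha : G.owner v = a) (hvu : G.edge v u)
    (hU : u ∈ U ∪ attr G X a U) : v ∈ U ∪ attr G X a U := by
  rw [union_attr] at hU ⊢
  obtain ⟨k, hk⟩ := Set.mem_iUnion.1 hU
  exact Set.mem_iUnion.2 ⟨k + 1, Or.inl (Or.inl ⟨hv, ha, u, hu, hvu, hk⟩)⟩

/-- The live groups in `Hl` are respected along `ρ`. -/
def GroupsHold (Hl : Set (Set (V × V))) (ρ : ℕ → V) : Prop :=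
  ∀ K ∈ Hl, (∃ᶠ k in atTop, ρ k ∈ src K) → ∃ᶠ k in atTop, (ρ k, ρ (k + 1)) ∈ K

/-- If B were eventually avoided, late visits to `cpre` would be at vertices of Player a, as the
opponent's vertices there have no other successor in X. These are sources of the group, which must
then be taken into B. The larger source set S covers the attractor groups, which start anywhere in
`cpreIter (k + 1)`. -/
theorem frequently_mem_of_cpre {G : GameGraph V} {X B S : Set V} {a : Fin 2} {ρ : ℕ → V}
    (hρ : IsPlay G ρ) (hX : ∀ᶠ k in atTop, ρ k ∈ X) (hS : cpre G X a B ⊆ S)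
    (hK : GroupsHold {{e | G.edge e.1 e.2 ∧ G.owner e.1 = a ∧ e.1 ∈ S ∧ e.2 ∈ B}} ρ)
    (h : ∃ᶠ k in atTop, ρ k ∈ cpre G X a B) : ∃ᶠ k in atTop, ρ k ∈ B := by
  rw [← frequently_shift 1]
  by_contra hB
  rw [not_frequently] at hB
  have hX' : ∀ᶠ k in atTop, ρ (k + 1) ∈ X := (tendsto_add_atTop_nat 1).eventually hX
  refine hK _ rfl ?_ (hB.mono fun k hk he => hk he.2.2.2)
  refine (h.and_eventually (hB.and hX')).mono ?_
  rintro k ⟨hk | hk, hkB, hkX⟩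
  · obtain ⟨hkX, ho, u, huX, he, hu⟩ := hk
    exact ⟨(ρ k, u), ⟨he, ho, hS (Or.inl ⟨hkX, ho, u, huX, he, hu⟩), hu⟩, rfl⟩
  · exact absurd (hk.2.2 _ hkX (hρ k)) hkB

/-- Infinitely many visits are pushed towards T: the assumption group crosses the opponent's
frontier of a pass, and the strategy groups descend the attractor one level at a time. -/
theorem frequently_mem_of_live [Finite V] {G : GameGraph V} {W T : Set V} {i : Fin 2} {ρ : ℕ → V}
    (hρ : IsPlay G ρ) (hW : ∀ᶠ k in atTop, ρ k ∈ W) (hreach : W ⊆ ⋃ k, liveU G W T i k)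
    (hs : GroupsHold (liveS G W T i) ρ) (ha : GroupsHold (liveA G W T i) ρ) :
    ∃ᶠ k in atTop, ρ k ∈ T := by
  have main : ∀ n, (∃ᶠ k in atTop, ρ k ∈ liveU G W T i n) → ∃ᶠ k in atTop, ρ k ∈ T := by
    intro n
    induction n with
    | zero => exact id
    | succ n ih =>
      intro hn
      by_cases hnW : liveU G W T i n = W
      · exact ih (hW.frequently.mono fun k hk => hnW.symm ▸ hk)
      have hU : ∃ᶠ k in atTop, ρ k ∈ liveU G W T i n ∪ attr G W i (liveU G W T i n) := by
        rcases frequently_or_distrib.1 hn with h | h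
        · exact h
        · refine frequently_mem_of_cpre hρ hW subset_rfl ?_ h
          rintro K rfl
          exact ha _ ⟨n, hnW, rfl⟩
      rw [union_attr] at hU
      obtain ⟨m, hm⟩ := frequently_mem_iUnion hU
      refine ih ?_
      induction m with
      | zero => exact hm
      | succ m ihm =>
        rcases frequently_or_distrib.1 hm with h | h
        · refine ihm (frequently_mem_of_cpre hρ hW
            (S := cpreIter G W i (liveU G W T i n) (m + 1)) Set.subset_union_left ?_ h)
          rintro K rfl
          exact hs _ ⟨n, hnW, m, rfl⟩
        · exact ihm h
  obtain ⟨n, hn⟩ := frequently_mem_iUnion (hW.mono fun k hk => hreach hk).frequently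
  exact main n hn

/-- The union of the passes is closed under predecessors in W: those of Player i enter through the
attractor, the others through the frontier. -/
theorem mem_iUnion_liveU {G : GameGraph V} {W T : Set V} {i : Fin 2} {ρ : ℕ → V} (hρ : IsPlay G ρ)
    (hW : ∀ k, ρ k ∈ W) {n : ℕ} (hn : ρ n ∈ T) : ρ 0 ∈ ⋃ k, liveU G W T i k := by
  refine mem_of_path (fun v hv u hu hA hvu => ?_) hρ hW (Set.mem_iUnion.2 ⟨0, hn⟩)
  obtain ⟨k, hk⟩ := Set.mem_iUnion.1 hA
  refine Set.mem_iUnion.2 ⟨k + 1, ?_⟩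
  rcases eq_or_eq_one_sub (G.owner v) i with ho | ho
  · exact Or.inl (mem_union_attr_of_edge hv hu ho hvu (Or.inl hk))
  · exact Or.inr (Or.inl ⟨hv, ho, u, hu, hvu, Or.inl hk⟩)

theorem subset_liveU {G : GameGraph V} {W T : Set V} {i : Fin 2} (k : ℕ) :
    T ⊆ liveU G W T i k := by
  induction k with
  | zero => exact subset_rfl
  | succ k ih => exact fun v hv => Or.inl (Or.inl (ih hv))

/-- The assumption is not too strong. Any entry into U inside W uses the frontier group, since U is
closed under the attractor of Player i. If the group is eventually unused, the play settles outside
U, contradicting the visits to T ⊆ U, or inside U, where every move from a source belongs to the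
group. -/
theorem groupsHold_liveA {G : GameGraph V} {W T : Set V} {i : Fin 2} {ρ : ℕ → V}
    (hρ : IsPlay G ρ) (hW : ∀ᶠ k in atTop, ρ k ∈ W) (hT : ∃ᶠ k in atTop, ρ k ∈ T) :
    GroupsHold (liveA G W T i) ρ := by
  rintro K ⟨n, -, rfl⟩ hsrc
  set U := liveU G W T i n ∪ attr G W i (liveU G W T i n) with hU
  have hTU : T ⊆ U := fun v hv => Or.inl (subset_liveU n hv)
  have hW' : ∀ᶠ k in atTop, ρ (k + 1) ∈ W := (tendsto_add_atTop_nat 1).eventually hW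
  by_contra hc
  rw [not_frequently] at hc
  have hcl : ∀ᶠ k in atTop, ρ k ∈ Uᶜ → ρ (k + 1) ∈ Uᶜ := by
    filter_upwards [hc, hW, hW'] with k hk h1 h2 h3 h4
    rcases eq_or_eq_one_sub (G.owner (ρ k)) i with ho | ho
    · exact h3 (mem_union_attr_of_edge h1 h2 ho (hρ k) h4)
    · exact hk ⟨hρ k, ho, Or.inl ⟨h1, ho, _, h2, hρ k, h4⟩, h4⟩
  rcases eventually_or_of_closed hcl with h | h
  · have h' : ∀ᶠ k in atTop, ρ (k + 1) ∉ Uᶜ := (tendsto_add_atTop_nat 1).eventually h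
    obtain ⟨k, ⟨e, he, hek⟩, hkU, hkK⟩ := (hsrc.and_eventually (h'.and hc)).exists
    refine hkK ⟨hρ k, ?_, ?_, not_not.1 hkU⟩
    · exact hek ▸ he.2.1
    · exact hek ▸ he.2.2.1
  · exact hT (h.mono fun k hk hkT => hk (hTU hkT))

/-! ### One level of `ComputeSets` -/

theorem mem_coopIn_buchi_of_edge {G : GameGraph V} {X I : Set V} {v u : V} (hv : v ∈ X)
    (hvu : G.edge v u) (hu : u ∈ coopIn G X (LTL.infOften (LTL.atom I))) :
    v ∈ coopIn G X (LTL.infOften (LTL.atom I)) := by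
  obtain ⟨ρ, hρ, hX, rfl, hI⟩ := mem_coopIn_buchi.1 hu
  refine mem_coopIn_buchi.2 ⟨consPath v ρ, hρ.consPath hvu, ?_, rfl, frequently_consPath.2 hI⟩
  rintro (_ | k)
  exacts [hv, hX k]

theorem mem_coopIn_buchi_of_play {G : GameGraph V} {X I : Set V} {ρ : ℕ → V} (hρ : IsPlay G ρ)
    {n : ℕ} (hX : ∀ k, n ≤ k → ρ k ∈ X) (hI : ∃ᶠ k in atTop, ρ k ∈ I) :
    ρ n ∈ coopIn G X (LTL.infOften (LTL.atom I)) :=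
  mem_coopIn_buchi.2 ⟨fun m => ρ (m + n), hρ.shift n, fun m => hX _ (by omega), by simp,
    (frequently_shift (p := fun k => ρ k ∈ I) n).2 hI⟩

theorem nextRegion_of_odd {G : GameGraph V} {X : Set V} {P : V → ℕ} (h : topPrio P X % 2 = 1) :
    nextRegion G X P = coopIn G (X \ prioSet P (topPrio P X)) (parity P) := if_pos h

theorem nextRegion_of_even {G : GameGraph V} {X : Set V} {P : V → ℕ} (h : topPrio P X % 2 ≠ 1) :
    nextRegion G X P =
      X \ coopIn G X (LTL.infOften (LTL.atom (prioSet P (topPrio P X)))) := if_neg h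

/-- For an even top priority, infinitely many visits to it would place the play in the Büchi region
that was removed. -/
theorem eventually_ne_topPrio {G : GameGraph V} {X : Set V} {P : V → ℕ} {ρ : ℕ → V}
    (hρ : IsPlay G ρ) (hX : ∀ᶠ k in atTop, ρ k ∈ nextRegion G X P) :
    ∀ᶠ k in atTop, P (ρ k) ≠ topPrio P X := by
  by_cases hd : topPrio P X % 2 = 1
  · rw [nextRegion_of_odd hd] at hX
    exact hX.mono fun k hk => (coopIn_subset hk).2
  · rw [nextRegion_of_even hd] at hX
    by_contra hc
    obtain ⟨n, hn⟩ := eventually_atTop.1 hX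
    exact (hn n le_rfl).2 (mem_coopIn_buchi_of_play hρ (fun k hk => (hn k hk).1)
      (hc : ∃ᶠ k in atTop, P (ρ k) = _))

theorem parityHolds_mergeTop_iff {G : GameGraph V} {X : Set V} {P : V → ℕ} {ρ : ℕ → V}
    (hρ : IsPlay G ρ) (hX : ∀ᶠ k in atTop, ρ k ∈ nextRegion G X P) :
    ParityHolds (mergeTop P (topPrio P X)) ρ ↔ ParityHolds P ρ := by
  refine ParityHolds.congr ?_
  filter_upwards [eventually_ne_topPrio hρ hX] with k hk
  simp [mergeTop, hk]

/-- In the even case the removed Büchi region is closed under predecessors in X, so a winning path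
starting outside it never enters it. -/
theorem ParityLive.nextRegion [Finite V] {G : GameGraph V} {X : Set V} {P : V → ℕ}
    (h : ParityLive G X P) :
    ParityLive G (nextRegion G X P) (mergeTop P (topPrio P X)) := by
  intro v hv
  suffices ∃ ρ, IsPlay G ρ ∧ (∀ k, ρ k ∈ Negotiation.nextRegion G X P) ∧ ρ 0 = v ∧
      ParityHolds P ρ by
    obtain ⟨ρ, hρ, hX, h0, hP⟩ := this
    exact ⟨ρ, hρ, hX, h0, (parityHolds_mergeTop_iff hρ (Eventually.of_forall hX)).2 hP⟩
  by_cases hd : topPrio P X % 2 = 1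
  · rw [nextRegion_of_odd hd] at hv ⊢
    exact parityLive_coopIn G _ P v hv
  · rw [nextRegion_of_even hd] at hv ⊢
    obtain ⟨ρ, hρ, hX, rfl, hP⟩ := h v hv.1
    refine ⟨ρ, hρ, fun k => ⟨hX k, fun hk => hv.2 ?_⟩, rfl, hP⟩
    exact mem_of_path (fun v hv u _ hu hvu => mem_coopIn_buchi_of_edge hv hvu hu) hρ hX hk

/-- No priority in X exceeds the odd top one, so the latter is seen finitely often and a tail of the
play witnesses membership. -/
theorem ParityHolds.eventually_mem_nextRegion [Finite V] {G : GameGraph V} {X : Set V} {P : V → ℕ}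
    {ρ : ℕ → V} (hP : ParityHolds P ρ) (hρ : IsPlay G ρ) (hX : ∀ᶠ k in atTop, ρ k ∈ X)
    (hd : topPrio P X % 2 = 1) : ∀ᶠ k in atTop, ρ k ∈ nextRegion G X P := by
  have hne : ∀ᶠ k in atTop, P (ρ k) ≠ topPrio P X := by
    by_contra hc
    obtain ⟨j, hj, -, hjf⟩ := hP _ hd (hc : ∃ᶠ k in atTop, P (ρ k) = _)
    obtain ⟨k, hk, hkX⟩ := (hjf.and_eventually hX).exists
    have := le_topPrio P hkX
    omega
  obtain ⟨n, hn⟩ := eventually_atTop.1 (hX.and hne)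
  rw [nextRegion_of_odd hd]
  exact eventually_atTop.2 ⟨n, fun k hk => hP.mem_coopIn hρ (fun k hk => hn k hk) hk⟩

theorem nextRegion_or_of_even {G : GameGraph V} {X : Set V} {P : V → ℕ} {ρ : ℕ → V}
    (hρ : IsPlay G ρ) (hX : ∀ᶠ k in atTop, ρ k ∈ X) (hd : topPrio P X % 2 ≠ 1) :
    (∀ᶠ k in atTop, ρ k ∈ nextRegion G X P) ∨
      ∀ᶠ k in atTop, ρ k ∈ coopIn G X (LTL.infOften (LTL.atom (prioSet P (topPrio P X)))) := by
  rw [nextRegion_of_even hd]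
  refine (eventually_or_of_closed ?_).symm.imp id fun h => ?_
  · filter_upwards [hX, (tendsto_add_atTop_nat 1).eventually hX] with k h1 h2 h3
    exact ⟨h2, fun hk => h3.2 (mem_coopIn_buchi_of_edge h1 (hρ k) hk)⟩
  · filter_upwards [hX, h] with k h1 h2
    exact not_not.1 fun hc => h2 ⟨h1, hc⟩

theorem coLiveU_zero_nextRegion [Finite V] {G : GameGraph V} {X : Set V} {P : V → ℕ}
    (h : ParityLive G X P) : coLiveU G X (nextRegion G X P) 0 = nextRegion G X P :=
  h.nextRegion.coopIn_alw (nextRegion_subset G X P)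

theorem subset_iUnion_coLiveU [Finite V] {G : GameGraph V} {X : Set V} {P : V → ℕ}
    (h : ParityLive G X P) (hd : topPrio P X % 2 = 1) :
    X ⊆ ⋃ k, coLiveU G X (nextRegion G X P) k := by
  intro v hv
  obtain ⟨ρ, hρ, hX, rfl, hP⟩ := h v hv
  obtain ⟨n, hn⟩ := (hP.eventually_mem_nextRegion hρ (Eventually.of_forall hX) hd).exists
  exact mem_iUnion_coLiveU hρ hX ((coLiveU_zero_nextRegion h).symm ▸ hn)

theorem coopIn_buchi_subset_iUnion_liveU {G : GameGraph V} {X : Set V} {P : V → ℕ} {i : Fin 2}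
    {d l : ℕ} (hd : d % 2 = 0) (hl : l < d) :
    let W := coopIn G X (LTL.infOften (LTL.atom (prioSet P d)))
    W ⊆ ⋃ k, liveU G W (liveTarget P W d l) i k := by
  intro W v hv
  obtain ⟨ρ, hρ, hX, rfl, hI⟩ := mem_coopIn_buchi.1 hv
  have hW : ∀ k, ρ k ∈ W := fun k => mem_coopIn_buchi_of_play hρ (fun m _ => hX m) hI
  obtain ⟨n, hn⟩ := hI.exists
  have hn' : P (ρ n) = d := hn
  exact mem_iUnion_liveU hρ hW (n := n) ⟨hW n, by omega, by omega, by omega⟩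

/-- The assumption part of the collected sets, and the co-Büchi condition, on a word. -/
def Sets.AssumptionHolds (A : Sets V) (ρ : ℕ → V) : Prop :=
  CoLiveHolds A.Da ρ ∧ CondLiveHolds A.Ha ρ ∧ ∀ᶠ k in atTop, ρ k ∉ A.C

/-- The co-live and conditional live-group parts of the collected sets, on a word. -/
def Sets.TemplatesHold (A : Sets V) (ρ : ℕ → V) : Prop :=
  (CoLiveHolds A.Da ρ ∧ CondLiveHolds A.Ha ρ) ∧ CoLiveHolds A.Ds ρ ∧ CondLiveHolds A.Hs ρ

theorem Sets.AssumptionHolds.union {A B : Sets V} {ρ : ℕ → V} (hA : A.AssumptionHolds ρ)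
    (hB : B.AssumptionHolds ρ) : (A.union B).AssumptionHolds ρ := by
  refine ⟨CoLiveHolds.union.2 ⟨hA.1, hB.1⟩, CondLiveHolds.union.2 ⟨hA.2.1, hB.2.1⟩, ?_⟩
  filter_upwards [hA.2.2, hB.2.2] with k h1 h2 h
  exact h.elim h1 h2

theorem Sets.templatesHold_union {A B : Sets V} {ρ : ℕ → V} :
    (A.union B).TemplatesHold ρ ↔ A.TemplatesHold ρ ∧ B.TemplatesHold ρ := by
  simp only [TemplatesHold, Sets.union, CoLiveHolds.union, CondLiveHolds.union]
  tauto

theorem levelSets_of_odd {G : GameGraph V} {i : Fin 2} {X : Set V} {P : V → ℕ}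
    (h : topPrio P X % 2 = 1) : levelSets G i X P =
      ⟨X \ nextRegion G X P, coLive G X (nextRegion G X P) i,
        coLive G X (nextRegion G X P) (1 - i), ∅, ∅⟩ := if_pos h

theorem levelSets_of_even {G : GameGraph V} {i : Fin 2} {X : Set V} {P : V → ℕ}
    (h : topPrio P X % 2 ≠ 1) : levelSets G i X P =
      let d := topPrio P X
      let W := coopIn G X (LTL.infOften (LTL.atom (prioSet P d)))
      ⟨∅, ∅, ∅,
        {c | ∃ l, l % 2 = 1 ∧ l ≤ d ∧ c = (W ∩ prioSet P l, liveS G W (liveTarget P W d l) i)},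
        {c | ∃ l, l % 2 = 1 ∧ l ≤ d ∧ c = (W ∩ prioSet P l, liveA G W (liveTarget P W d l) i)}⟩ :=
  if_neg h

/-- Co-live edges start in X and the guards of the live groups lie in X, so everything is vacuous.
-/
theorem levelSets_assumptionHolds_of_notMem {G : GameGraph V} {i : Fin 2} {X : Set V} {P : V → ℕ}
    {ρ : ℕ → V} (hX : ∀ᶠ k in atTop, ρ k ∉ X) : (levelSets G i X P).AssumptionHolds ρ := by
  by_cases hd : topPrio P X % 2 = 1
  · rw [levelSets_of_odd hd]
    refine ⟨CoLiveHolds.of_eventually ?_, fun c hc => hc.elim, hX.mono fun k hk h => hk h.1⟩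
    exact hX.mono fun k hk h => hk (fst_mem_of_mem_coLive h)
  · rw [levelSets_of_even hd]
    refine ⟨fun e he => he.elim, ?_, Eventually.of_forall fun k hk => hk⟩
    rintro c ⟨l, -, -, rfl⟩ hc
    exact (hc (hX.mono fun k hk h => hk (coopIn_subset h.1))).elim

/-- The dichotomy in the conclusion decides whether the deeper levels are handled by induction or
are vacuous. -/
theorem ParityHolds.levelSets_assumptionHolds [Finite V] {G : GameGraph V} {i : Fin 2} {X : Set V}
    {P : V → ℕ} {ρ : ℕ → V} (hP : ParityHolds P ρ) (hlive : ParityLive G X P) (hρ : IsPlay G ρ)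
    (hX : ∀ᶠ k in atTop, ρ k ∈ X) : (levelSets G i X P).AssumptionHolds ρ ∧
      ((∀ᶠ k in atTop, ρ k ∈ nextRegion G X P) ∨ ∀ᶠ k in atTop, ρ k ∉ nextRegion G X P) := by
  by_cases hd : topPrio P X % 2 = 1
  · have hN := hP.eventually_mem_nextRegion hρ hX hd
    refine ⟨?_, Or.inl hN⟩
    rw [levelSets_of_odd hd]
    refine ⟨CoLiveHolds.of_eventually ?_, fun c hc => hc.elim, hN.mono fun k hk h => h.2 hk⟩
    filter_upwards [hN, (tendsto_add_atTop_nat 1).eventually hN] with k h1 h2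
    rw [← coLiveU_zero_nextRegion hlive] at h1 h2
    exact notMem_coLive h1 h2
  · rcases nextRegion_or_of_even hρ hX hd with hN | hW
    · refine ⟨?_, Or.inl hN⟩
      rw [levelSets_of_even hd]
      refine ⟨fun e he => he.elim, ?_, Eventually.of_forall fun k hk => hk⟩
      rintro c ⟨l, -, -, rfl⟩ hc
      rw [nextRegion_of_even hd] at hN
      exact (hc (hN.mono fun k hk h => hk.2 h.1)).elim
    · refine ⟨?_, Or.inr (hW.mono fun k hk h => ?_)⟩
      · rw [levelSets_of_even hd]
        refine ⟨fun e he => he.elim, ?_, Eventually.of_forall fun k hk => hk⟩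
        rintro c ⟨l, hl, -, rfl⟩ hc
        obtain ⟨j, hlj, hj, hjf⟩ := hP l hl (hc.mono fun k hk => hk.2)
        refine groupsHold_liveA hρ hW ((hjf.and_eventually hW).mono ?_)
        rintro k ⟨hk, hkW⟩
        exact ⟨hkW, hk ▸ hlj, le_topPrio P (coopIn_subset hkW), hk ▸ hj⟩
      · rw [nextRegion_of_even hd] at h
        exact h.2 hk

/-- An odd level pushes the play into the next region. At an even level a play settling in the Büchi
region activates the guard of each odd l seen infinitely often, and the live groups answer with
larger even priorities. -/
theorem levelSets_sound [Finite V] {G : GameGraph V} {i : Fin 2} {X : Set V} {P : V → ℕ}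
    {ρ : ℕ → V} (hlive : ParityLive G X P) (hρ : IsPlay G ρ) (hX : ∀ᶠ k in atTop, ρ k ∈ X)
    (h : (levelSets G i X P).TemplatesHold ρ) :
    (∀ᶠ k in atTop, ρ k ∈ nextRegion G X P) ∨ ParityHolds P ρ := by
  by_cases hd : topPrio P X % 2 = 1
  · rw [levelSets_of_odd hd] at h
    left
    have := eventually_mem_of_coLive hρ hX (subset_iUnion_coLiveU hlive hd) h.2.1 h.1.1
    rwa [coLiveU_zero_nextRegion hlive] at this
  · refine (nextRegion_or_of_even hρ hX hd).imp id fun hW => ?_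
    rw [levelSets_of_even hd] at h
    intro l hl hlf
    have hld : l ≤ topPrio P X := by
      obtain ⟨k, hk, hkX⟩ := (hlf.and_eventually hX).exists
      exact hk ▸ le_topPrio P hkX
    have hc := hlf.and_eventually hW
    have hT := frequently_mem_of_live hρ hW
      (coopIn_buchi_subset_iUnion_liveU (by omega) (by omega))
      (h.2.2 _ ⟨l, hl, hld, rfl⟩ (hc.mono fun k hk => ⟨hk.2, hk.1⟩))
      (h.1.2 _ ⟨l, hl, hld, rfl⟩ (hc.mono fun k hk => ⟨hk.2, hk.1⟩))
    -- The target mixes several even priorities; the pigeonhole principle extracts one that recurs.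
    obtain ⟨j, hj⟩ := frequently_mem_iUnion (A := fun j => {v | l < P v ∧ P v % 2 = 0 ∧ P v = j})
      (hT.mono fun k hk => Set.mem_iUnion.2 ⟨P (ρ k), hk.2.1, hk.2.2.2, rfl⟩)
    obtain ⟨k, h1, h2, h3⟩ := hj.exists
    exact ⟨j, h3 ▸ h1, h3 ▸ h2, hj.mono fun k hk => hk.2.2⟩

/-! ### Correctness of `ComputeSets` -/

theorem computeSets_assumptionHolds_of_notMem [Finite V] {G : GameGraph V} {i : Fin 2} {X : Set V}
    {P : V → ℕ} {ρ : ℕ → V} (hX : ∀ᶠ k in atTop, ρ k ∉ X) :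
    (computeSets G i X P).AssumptionHolds ρ := by
  induction X, P using computeSets.induct G with
  | case1 P =>
    rw [computeSets, if_pos rfl]
    exact ⟨fun e he => he.elim, fun c hc => hc.elim, Eventually.of_forall fun k hk => hk⟩
  | case2 X P h0 hd ih =>
    rw [computeSets, if_neg h0, dif_pos hd]
    exact (levelSets_assumptionHolds_of_notMem hX).union
      (ih (hX.mono fun k hk h => hk (nextRegion_subset G X P h)))
  | case3 X P h0 hd =>
    rw [computeSets, if_neg h0, dif_neg hd]
    exact levelSets_assumptionHolds_of_notMem hX

theorem ParityHolds.computeSets_assumptionHolds [Finite V] {G : GameGraph V} {i : Fin 2}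
    {X : Set V} {P : V → ℕ} {ρ : ℕ → V} (hP : ParityHolds P ρ) (hlive : ParityLive G X P)
    (hρ : IsPlay G ρ) (hX : ∀ᶠ k in atTop, ρ k ∈ X) :
    (computeSets G i X P).AssumptionHolds ρ := by
  induction X, P using computeSets.induct G with
  | case1 P => exact computeSets_assumptionHolds_of_notMem (hX.mono fun k hk => hk.elim)
  | case2 X P h0 hd ih =>
    rw [computeSets, if_neg h0, dif_pos hd]
    obtain ⟨hA, hN⟩ := hP.levelSets_assumptionHolds (i := i) hlive hρ hX
    refine hA.union ?_
    rcases hN with hN | hN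
    · exact ih ((parityHolds_mergeTop_iff hρ hN).2 hP) hlive.nextRegion hN
    · exact computeSets_assumptionHolds_of_notMem hN
  | case3 X P h0 hd =>
    rw [computeSets, if_neg h0, dif_neg hd]
    exact (hP.levelSets_assumptionHolds hlive hρ hX).1

theorem computeSets_sound [Finite V] {G : GameGraph V} {i : Fin 2} {X : Set V} {P : V → ℕ}
    {ρ : ℕ → V} (hlive : ParityLive G X P) (hρ : IsPlay G ρ) (hX : ∀ᶠ k in atTop, ρ k ∈ X)
    (h : (computeSets G i X P).TemplatesHold ρ) : ParityHolds P ρ := by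
  induction X, P using computeSets.induct G with
  | case1 P => exact hX.exists.choose_spec.elim
  | case2 X P h0 hd ih =>
    rw [computeSets, if_neg h0, dif_pos hd, Sets.templatesHold_union] at h
    refine (levelSets_sound hlive hρ hX h.1).elim (fun hN => ?_) id
    exact (parityHolds_mergeTop_iff hρ hN).1 (ih hlive.nextRegion hN h.2)
  | case3 X P h0 hd =>
    rw [computeSets, if_neg h0, dif_neg hd] at h
    refine (levelSets_sound hlive hρ hX h).elim (fun hN => ?_) id
    -- With top priority 0 the next region cannot hold a play: its priorities would be at most 0 yet
    -- eventually nonzero.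
    obtain ⟨k, h1, h2⟩ := ((eventually_ne_topPrio hρ hN).and hX).exists
    have := le_topPrio P h2
    omega

/-! ### Ownership of the collected edges -/

/-- All edges in `D` and in the live groups of `H` are edges of `G` with source owned by Player
`a`. -/
def EdgesOwned (G : GameGraph V) (a : Fin 2) (D : Set (V × V))
    (H : Set (Set V × Set (Set (V × V)))) : Prop :=
  (∀ e ∈ D, G.owner e.1 = a) ∧
    ∀ c ∈ H, ∀ K ∈ c.2, ∀ e ∈ K, G.edge e.1 e.2 ∧ G.owner e.1 = a

theorem EdgesOwned.union {G : GameGraph V} {a : Fin 2} {D D' : Set (V × V)}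
    {H H' : Set (Set V × Set (Set (V × V)))} (h : EdgesOwned G a D H)
    (h' : EdgesOwned G a D' H') : EdgesOwned G a (D ∪ D') (H ∪ H') :=
  ⟨fun e he => he.elim (h.1 e) (h'.1 e), fun c hc => hc.elim (h.2 c) (h'.2 c)⟩

theorem levelSets_edgesOwned (G : GameGraph V) (i : Fin 2) (X : Set V) (P : V → ℕ) :
    EdgesOwned G i (levelSets G i X P).Ds (levelSets G i X P).Hs ∧
      EdgesOwned G (1 - i) (levelSets G i X P).Da (levelSets G i X P).Ha := by
  by_cases hd : topPrio P X % 2 = 1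
  · rw [levelSets_of_odd hd]
    exact ⟨⟨fun e he => he.2.1, fun c hc => hc.elim⟩, fun e he => he.2.1, fun c hc => hc.elim⟩
  · rw [levelSets_of_even hd]
    refine ⟨⟨fun e he => he.elim, ?_⟩, fun e he => he.elim, ?_⟩
    · rintro c ⟨l, -, -, rfl⟩ K ⟨n, -, m, rfl⟩ e he
      exact ⟨he.1, he.2.1⟩
    · rintro c ⟨l, -, -, rfl⟩ K ⟨n, -, rfl⟩ e he
      exact ⟨he.1, he.2.1⟩

theorem computeSets_edgesOwned [Finite V] (G : GameGraph V) (i : Fin 2) (X : Set V) (P : V → ℕ) :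
    EdgesOwned G i (computeSets G i X P).Ds (computeSets G i X P).Hs ∧
      EdgesOwned G (1 - i) (computeSets G i X P).Da (computeSets G i X P).Ha := by
  induction X, P using computeSets.induct G with
  | case1 P =>
    rw [computeSets, if_pos rfl]
    exact ⟨⟨fun e he => he.elim, fun c hc => hc.elim⟩, fun e he => he.elim, fun c hc => hc.elim⟩
  | case2 X P h0 hd ih =>
    rw [computeSets, if_neg h0, dif_pos hd]
    have h := levelSets_edgesOwned G i X P
    exact ⟨h.1.union ih.1, h.2.union ih.2⟩
  | case3 X P h0 hd =>
    rw [computeSets, if_neg h0, dif_neg hd]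
    exact levelSets_edgesOwned G i X P

/-- All edges of the template have their source owned by Player `a`, and the live groups consist of
edges of `G`. -/
def Template.Owned (G : GameGraph V) (a : Fin 2) (T : Template V) : Prop :=
  (∀ e ∈ T.S, G.owner e.1 = a) ∧ EdgesOwned G a T.D T.H

theorem Template.Owned.conj {G : GameGraph V} {a : Fin 2} {T T' : Template V}
    (h : T.Owned G a) (h' : T'.Owned G a) : (T.conj T').Owned G a :=
  ⟨fun e he => he.elim (h.1 e) (h'.1 e), h.2.union h'.2⟩

theorem parityTemp_Psi_owned [Finite V] (G : GameGraph V) (X : Set V) (P : V → ℕ) (i : Fin 2) :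
    (parityTemp G X P i).Psi.Owned G (1 - i) :=
  ⟨fun _ he => he.2.1, (computeSets_edgesOwned G i _ P).2⟩

theorem parityTemp_Pi_owned [Finite V] (G : GameGraph V) (X : Set V) (P : V → ℕ) (i : Fin 2) :
    (parityTemp G X P i).Pi.Owned G i :=
  ⟨fun _ he => he.2.1, (computeSets_edgesOwned G i _ P).1⟩

/-! ### Correctness of `ParityTemp` -/

theorem parityTemp_W_subset [Finite V] {G : GameGraph V} {X : Set V} {P : V → ℕ} {i : Fin 2} :
    (parityTemp G X P i).W ⊆ X :=
  coopIn_subset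

theorem mem_safetyEdges_iff [Finite V] {G : GameGraph V} {X : Set V} {P : V → ℕ} {j : Fin 2}
    {e : V × V} : e ∈ safetyEdges G (coopIn G X (parity P)) j ↔
      G.edge e.1 e.2 ∧ G.owner e.1 = j ∧ e.1 ∈ coopIn G X (parity P) ∧
        e.2 ∉ coopIn G X (parity P) := by
  rw [safetyEdges, (parityLive_coopIn G X P).coopIn_alw (Set.subset_univ _)]
  rfl

theorem ParityHolds.parityTemp_complete [Finite V] {G : GameGraph V} {X : Set V} {P : V → ℕ}
    {ρ : ℕ → V} (hP : ParityHolds P ρ) (hρ : IsPlay G ρ) (hX : ∀ k, ρ k ∈ X) (i : Fin 2) :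
    (∀ k, ρ k ∈ (parityTemp G X P i).W) ∧ (∀ᶠ k in atTop, ρ k ∉ (parityTemp G X P i).C) ∧
      (parityTemp G X P i).Psi.formula.sat ρ 0 := by
  have hW : ∀ k, ρ k ∈ (parityTemp G X P i).W := fun k =>
    hP.mem_coopIn hρ (n := 0) (fun k _ => hX k) (Nat.zero_le k)
  obtain ⟨h1, h2, h3⟩ := hP.computeSets_assumptionHolds (i := i) (parityLive_coopIn G X P) hρ
    (Eventually.of_forall hW)
  refine ⟨hW, h3, sat_formula.2 ⟨fun k hk => ?_, h1, h2⟩⟩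
  exact (mem_safetyEdges_iff.1 hk).2.2.2 (hW (k + 1))

/-- The unsafe edges of Ψ and Π together are all edges leaving W, so the play is confined to W and
`computeSets_sound` applies. -/
theorem parityTemp_sound [Finite V] {G : GameGraph V} {X : Set V} {P : V → ℕ} {i : Fin 2}
    {ρ : ℕ → V} (hρ : IsPlay G ρ) (h0 : ρ 0 ∈ (parityTemp G X P i).W)
    (hPsi : (parityTemp G X P i).Psi.formula.sat ρ 0)
    (hPi : (parityTemp G X P i).Pi.formula.sat ρ 0) :
    (∀ k, ρ k ∈ X) ∧ ParityHolds P ρ := by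
  obtain ⟨hPsiS, hPsiD, hPsiH⟩ := sat_formula.1 hPsi
  obtain ⟨hPiS, hPiD, hPiH⟩ := sat_formula.1 hPi
  have hW : ∀ k, ρ k ∈ coopIn G X (parity P) := by
    intro k
    induction k with
    | zero => exact h0
    | succ k ih =>
      by_contra hc
      rcases eq_or_eq_one_sub (G.owner (ρ k)) i with ho | ho
      · exact hPiS k (mem_safetyEdges_iff.2 ⟨hρ k, ho, ih, hc⟩)
      · exact hPsiS k (mem_safetyEdges_iff.2 ⟨hρ k, ho, ih, hc⟩)
  exact ⟨fun k => coopIn_subset (hW k), computeSets_sound (parityLive_coopIn G X P) hρ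
    (Eventually.of_forall hW) ⟨⟨hPsiD, hPsiH⟩, hPiD, hPiH⟩⟩

/-! ### Strategies -/

theorem exists_seq_frequently {A : Set V} [Finite V] (hA : A.Nonempty) :
    ∃ f : ℕ → V, (∀ n, f n ∈ A) ∧ ∀ w ∈ A, ∃ᶠ n in atTop, f n = w := by
  have := hA.to_subtype
  obtain ⟨g, hg⟩ := exists_surjective_nat A
  -- The first coordinate of `Nat.unpair` takes each value m at the arbitrarily late index `Nat.pair
  -- m a`.
  refine ⟨fun n => g n.unpair.1, fun n => (g _).2, fun w hw => frequently_atTop.2 fun a => ?_⟩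
  obtain ⟨m, hm⟩ := hg ⟨w, hw⟩
  exact ⟨Nat.pair m a, Nat.right_le_pair m a, by simp [hm]⟩

open Classical in
theorem count_map_range (ρ : ℕ → V) (v : V) (k : ℕ) :
    ((List.range k).map ρ).count v = Nat.count (fun j => ρ j = v) k := by
  induction k with
  | zero => simp
  | succ k ih =>
    rw [List.range_succ, List.map_append, List.count_append, ih, Nat.count_succ]
    simp [List.count_singleton]

/-- If every vertex has an allowed successor, then Player `i` has a strategy that only uses allowed
edges and takes every allowed edge infinitely often if its source is visited infinitely often. -/
theorem exists_fair_strategy [Finite V] (G : GameGraph V) (i : Fin 2) (A : V → Set V)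
    (hA : ∀ v, (A v).Nonempty) (hedge : ∀ v, ∀ w ∈ A v, G.edge v w) :
    ∃ π : Strategy G i, ∀ ρ, Compliant π ρ →
      (∀ k, G.owner (ρ k) = i → ρ (k + 1) ∈ A (ρ k)) ∧
      ∀ v, G.owner v = i → (∃ᶠ k in atTop, ρ k = v) → ∀ w ∈ A v,
        ∃ᶠ k in atTop, ρ k = v ∧ ρ (k + 1) = w := by
  classical
  choose f hfA hf using fun v => exists_seq_frequently (hA v)
  -- The history excludes the current vertex, so the n-th visit to v, counted from 0, is answered by
  -- `f v n`.
  refine ⟨⟨fun h v => f v (h.count v), fun h v _ => hedge v _ (hfA v _)⟩, fun ρ hρ => ⟨?_, ?_⟩⟩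
  · intro k hk
    rw [hρ k hk]
    exact hfA _ _
  · intro v hv hfreq w hw
    refine frequently_atTop.2 fun a => ?_
    obtain ⟨n, hn, hfn⟩ := frequently_atTop.1 (hf v w hw) a
    have hinf : {k | ρ k = v}.Infinite := Nat.frequently_atTop_iff_infinite.1 hfreq
    have hk : ρ (Nat.nth (fun k => ρ k = v) n) = v := Nat.nth_mem_of_infinite hinf n
    refine ⟨Nat.nth (fun k => ρ k = v) n, hn.trans (Nat.nth_strictMono hinf).le_apply, hk, ?_⟩
    rw [hρ _ (by rwa [hk]), hk]
    simp only [count_map_range]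
    rw [Nat.count_nth_of_infinite hinf, hfn]

/-- A fair strategy on the edges outside S ∪ D works: if a group's sources recur, one source vertex
does, and its allowed edge in the group is then taken infinitely often, whatever the guard says. -/
theorem CheckTemplate.exists_strategy [Finite V] {G : GameGraph V} {T : Template V} {i : Fin 2}
    (hT : CheckTemplate G T) (hown : T.Owned G i) :
    ∃ π : Strategy G i, ∀ ρ, Compliant π ρ → T.formula.sat ρ 0 := by
  obtain ⟨π, hπ⟩ := exists_fair_strategy G i (fun v => {w | G.edge v w ∧ (v, w) ∉ T.D ∪ T.S}) hT.1
    fun v w hw => hw.1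
  refine ⟨π, fun ρ hρ => ?_⟩
  obtain ⟨hsafe, hfair⟩ := hπ ρ hρ
  refine sat_formula.2 ⟨fun k hk => ?_, CoLiveHolds.of_eventually (Eventually.of_forall ?_), ?_⟩
  · exact (hsafe k (hown.1 _ hk)).2 (Or.inr hk)
  · exact fun k hk => (hsafe k (hown.2.1 _ hk)).2 (Or.inl hk)
  · intro c hc _ K hK hsrc
    obtain ⟨v, hv, hvf⟩ := frequently_mem_exists_eq hsrc
    obtain ⟨w, hw, hwT⟩ := hT.2 c hc K hK v hv
    obtain ⟨he, ho⟩ := hown.2.2 c hc K hK _ hw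
    refine (hfair v ho hvf w ⟨he, hwT⟩).mono ?_
    rintro k ⟨rfl, rfl⟩
    exact hw

theorem sat_formula_conj [Finite V] {T T' : Template V} {ρ : ℕ → V} :
    (T.conj T').formula.sat ρ 0 ↔ T.formula.sat ρ 0 ∧ T'.formula.sat ρ 0 := by
  simp only [sat_formula, Template.conj, CoLiveHolds.union, CondLiveHolds.union, Set.mem_union,
    not_or, forall_and]
  tauto

theorem exists_compliant_play (G : GameGraph V) (π₀ : Strategy G 0) (π₁ : Strategy G 1) (v : V) :
    ∃ ρ, IsPlay G ρ ∧ Compliant π₀ ρ ∧ Compliant π₁ ρ ∧ ρ 0 = v := by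
  classical
  let move : List V → V → V := fun h u =>
    if G.owner u = 0 then π₀.move h u else π₁.move h u
  let s : ℕ → List V × V := fun k =>
    Nat.rec ([], v) (fun _ p => (p.1 ++ [p.2], move p.1 p.2)) k
  have hs : ∀ k, (s k).1 = (List.range k).map fun j => (s j).2 := by
    intro k
    induction k with
    | zero => rfl
    | succ k ih =>
      rw [List.range_succ, List.map_append, ← ih]
      rfl
  have hstep : ∀ k, (s (k + 1)).2 = move ((List.range k).map fun j => (s j).2) (s k).2 := by
    intro k
    rw [← hs k]
  have h0 : ∀ k, G.owner (s k).2 = 0 →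
      (s (k + 1)).2 = π₀.move ((List.range k).map fun j => (s j).2) (s k).2 := fun k hk => by
    rw [hstep k]
    exact if_pos hk
  have h1 : ∀ k, G.owner (s k).2 = 1 →
      (s (k + 1)).2 = π₁.move ((List.range k).map fun j => (s j).2) (s k).2 := fun k hk => by
    rw [hstep k]
    exact if_neg (by simp [hk])
  refine ⟨fun k => (s k).2, fun k => ?_, h0, h1, rfl⟩
  rcases eq_or_eq_one_sub (G.owner (s k).2) 0 with ho | ho
  · simpa only [h0 k ho] using π₀.legal _ _ ho
  · simpa only [h1 k ho] using π₁.legal _ _ ho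

/-! ### Correctness of `Negotiate` -/

/-- The new priority is odd and exceeds every other value, so seeing it infinitely often violates
parity. -/
theorem parityHolds_raise_iff [Finite V] {P : V → ℕ} {C : Set V} {ρ : ℕ → V} :
    ParityHolds (raise P C) ρ ↔ ParityHolds P ρ ∧ ∀ᶠ k in atTop, ρ k ∉ C := by
  have hcongr : (∀ᶠ k in atTop, ρ k ∉ C) → (ParityHolds (raise P C) ρ ↔ ParityHolds P ρ) :=
    fun h => ParityHolds.congr (h.mono fun k hk => by simp [raise, hk])
  refine ⟨fun h => ?_, fun h => (hcongr h.2).2 h.1⟩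
  suffices hC : ∀ᶠ k in atTop, ρ k ∉ C from ⟨(hcongr hC).1 h, hC⟩
  by_contra hC
  have hC' : ∃ᶠ k in atTop, raise P C (ρ k) = 2 * topPrio P Set.univ + 1 :=
    (not_eventually.1 hC).mono fun k hk => if_pos (not_not.1 hk)
  obtain ⟨j, hj, -, hjf⟩ := h _ (by omega) hC'
  obtain ⟨k, rfl⟩ := hjf.exists
  have := le_topPrio P (Set.mem_univ (ρ k))
  unfold raise at hj
  split_ifs at hj <;> omega

/-- The objective `Φ` says, on plays of `G`, that the play always stays in `X` and satisfies the
parity condition of `P`. -/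
def Represents (G : GameGraph V) (X : Set V) (P : V → ℕ) (Φ : LTL V) : Prop :=
  ∀ ρ, IsPlay G ρ → (Φ.sat ρ 0 ↔ (∀ k, ρ k ∈ X) ∧ ParityHolds P ρ)

theorem sat_step_iff {Φ : LTL V} {W C : Set V} {ρ : ℕ → V} :
    ((Φ.and (LTL.alw (LTL.atom W))).and (LTL.ev (LTL.alw (LTL.atom C).neg))).sat ρ 0 ↔
      Φ.sat ρ 0 ∧ (∀ k, ρ k ∈ W) ∧ ∀ᶠ k in atTop, ρ k ∉ C := by
  simp [LTL.sat, LTL.sat_alw, LTL.sat_ev_alw, and_assoc]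

theorem Represents.step [Finite V] {G : GameGraph V} {X W C : Set V} {P : V → ℕ} {Φ : LTL V}
    (h : Represents G X P Φ) (hW : W ⊆ X) : Represents G W (raise P C)
      ((Φ.and (LTL.alw (LTL.atom W))).and (LTL.ev (LTL.alw (LTL.atom C).neg))) := by
  intro ρ hρ
  rw [sat_step_iff, h ρ hρ, parityHolds_raise_iff]
  exact ⟨fun h => ⟨h.2.1, h.1.2, h.2.2⟩, fun h => ⟨⟨fun k => hW (h.1 k), h.2.1⟩, h.1, h.2.2⟩⟩

theorem NegotiateFrom.exists_final_round [Finite V] {G : GameGraph V} {X : Set V}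
    {P : Fin 2 → V → ℕ} {Φ : Fin 2 → LTL V} {out : Output V} (h : NegotiateFrom G X P Φ out)
    (hΦ : ∀ i, Represents G X (P i) (Φ i)) :
    ∃ X' P', RoundOK G X' P' ∧ (∀ i, out.Psi i = (parityTemp G X' (P' i) i).Psi) ∧
      (∀ i, Represents G X' (P' i) (out.obj i)) ∧
      ∀ ρ, IsPlay G ρ → ((∀ i, (Φ i).sat ρ 0) ↔ ∀ i, (out.obj i).sat ρ 0) := by
  induction h with
  | ret X P Φ h => exact ⟨X, P, h, fun _ => rfl, hΦ, fun _ _ => Iff.rfl⟩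
  | step X P Φ out h _ ih =>
    obtain ⟨X', P', hok, hPsi, hobj, hiff⟩ := ih fun i =>
      (hΦ i).step (Set.inter_subset_left.trans parityTemp_W_subset)
    refine ⟨X', P', hok, hPsi, hobj, fun ρ hρ => ?_⟩
    rw [← hiff ρ hρ]
    simp only [sat_step_iff]
    refine ⟨fun hs i => ⟨hs i, ?_⟩, fun hs i => (hs i).1⟩
    -- A single objective may shrink in a round. The added conjuncts mention both players' regions
    -- and are implied only by both objectives together.
    have key := fun i => (((hΦ i ρ hρ).1 (hs i)).2).parityTemp_complete hρ
      ((hΦ i ρ hρ).1 (hs i)).1 i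
    refine ⟨fun k => ⟨(key 0).1 k, (key 1).1 k⟩, ?_⟩
    filter_upwards [(key 0).2.1, (key 1).2.1] with k h0 h1 hk
    exact hk.elim h0 h1

theorem sat_contracted [Finite V] {out : Output V} {i : Fin 2} {ρ : ℕ → V} :
    (contracted out i).sat ρ 0 ↔ (out.Psi (1 - i)).formula.sat ρ 0 ∧
      ((out.Psi i).formula.sat ρ 0 → (out.obj i).sat ρ 0) := by
  rw [contracted, LTL.sat, LTL.sat_imp]

theorem forall_sat_iff {Φ : Fin 2 → LTL V} {ρ : ℕ → V} :
    ((Φ 0).and (Φ 1)).sat ρ 0 ↔ ∀ i, (Φ i).sat ρ 0 := by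
  rw [Fin.forall_fin_two, LTL.sat]

/-- A play satisfies both final objectives iff it satisfies both contracted specifications. -/
theorem contracted_iff [Finite V] {G : GameGraph V} {X : Set V} {P : Fin 2 → V → ℕ}
    {out : Output V} (hPsi : ∀ i, out.Psi i = (parityTemp G X (P i) i).Psi)
    (hobj : ∀ i, Represents G X (P i) (out.obj i)) {ρ : ℕ → V} (hρ : IsPlay G ρ) :
    (∀ i, (out.obj i).sat ρ 0) ↔ ∀ i, (contracted out i).sat ρ 0 := by
  simp only [sat_contracted]
  constructor
  · intro h
    have key : ∀ i, (out.Psi i).formula.sat ρ 0 := fun i => by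
      obtain ⟨hX, hP⟩ := (hobj i ρ hρ).1 (h i)
      rw [hPsi i]
      exact (hP.parityTemp_complete hρ hX i).2.2
    exact fun i => ⟨key _, fun _ => h i⟩
  · intro h i
    -- The assumption Ψ_i is discharged by the other player's specification, of which it is a
    -- conjunct.
    have := (h (1 - i)).1
    rw [one_sub_one_sub] at this
    exact (h i).2 this

theorem mem_winRegion_contracted [Finite V] {G : GameGraph V} {X : Set V} {P : Fin 2 → V → ℕ}
    {out : Output V} (hok : RoundOK G X P)
    (hPsi : ∀ i, out.Psi i = (parityTemp G X (P i) i).Psi)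
    (hobj : ∀ i, Represents G X (P i) (out.obj i)) {i : Fin 2} {v : V}
    (hv : v ∈ (parityTemp G X (P i) i).W) : v ∈ winRegion G i (contracted out i) := by
  have hown := parityTemp_Psi_owned G X (P (1 - i)) (1 - i)
  rw [one_sub_one_sub] at hown
  obtain ⟨π, hπ⟩ := (hok i).exists_strategy (hown.conj (parityTemp_Pi_owned G X (P i) i))
  refine ⟨π, fun ρ hρ hc h0 => ?_⟩
  obtain ⟨h1, h2⟩ := sat_formula_conj.1 (hπ ρ hc)
  rw [sat_contracted, hPsi, hPsi]
  exact ⟨h1, fun h => (hobj i ρ hρ).2 (parityTemp_sound hρ (h0 ▸ hv) h h2)⟩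

end Negotiation

theorem mainTheorem1 {V : Type*} [Finite V] (G : Negotiation.GameGraph V)
    (P : Fin 2 → V → ℕ) (out : Negotiation.Output V) (hout : Negotiation.Negotiate G P out) :
    Negotiation.IsIRmaC G (fun i => Negotiation.parity (P i))
      (fun i => Negotiation.contracted out i) := by
  open Negotiation in
  obtain ⟨X, P', hok, hPsi, hobj, hiff⟩ := NegotiateFrom.exists_final_round hout
    fun i ρ _ => by simp [sat_parity]
  have hsat : ∀ ρ, IsPlay G ρ → (((parity (P 0)).and (parity (P 1))).sat ρ 0 ↔
      ((contracted out 0).and (contracted out 1)).sat ρ 0) := fun ρ hρ =>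
    (forall_sat_iff (Φ := fun i => parity (P i))).trans <| (hiff ρ hρ).trans <|
      (contracted_iff hPsi hobj hρ).trans (forall_sat_iff (Φ := contracted out)).symm
  refine ⟨Set.ext fun ρ => and_congr_right (hsat ρ), Set.Subset.antisymm ?_ ?_⟩
  · rintro v ⟨π₀, π₁, hπ⟩
    -- `coopRegion` quantifies universally over compliant plays, so one has to be produced.
    obtain ⟨ρ, hρ, h0, h1, rfl⟩ := exists_compliant_play G π₀ π₁ v
    have hs := (hiff ρ hρ).1 (forall_sat_iff.1 (hπ ρ hρ h0 h1 rfl))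
    have hW : ∀ i, ρ 0 ∈ (parityTemp G X (P' i) i).W := fun i =>
      have hi := (hobj i ρ hρ).1 (hs i)
      (hi.2.parityTemp_complete hρ hi.1 i).1 0
    exact ⟨mem_winRegion_contracted hok hPsi hobj (hW 0),
      mem_winRegion_contracted hok hPsi hobj (hW 1)⟩
  · rintro v ⟨⟨π₀, h₀⟩, π₁, h₁⟩
    exact ⟨π₀, π₁, fun ρ hρ hc₀ hc₁ hv => (hsat ρ hρ).2 ⟨h₀ ρ hρ hc₀ hv, h₁ ρ hρ hc₁ hv⟩⟩
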